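/- Let $N\ge 1$, let $L=L(x,v,t)\in C^2(\mathbb R^N\times\mathbb R^N\times\mathbb R)$ be a Lagrangian whose Legendre map $(x,v,t)\mapsto(x,L_v(x,v,t),t)$ is a $C^1$-diffeomorphism of $\mathbb R^N\times\mathbb R^N\times\mathbb R$ onto itself, and let $H(x,p,t)=p\cdot v-L(x,v,t)$ with $p=L_v(x,v,t)$ be the corresponding Hamilton function. Let $S_0\in C^1(\mathbb R^N)$ and $T>0$. Suppose that for every $x_0\in\mathbb R^N$ the Cauchy problem $$\dot x=H_p(x,p,t),\qquad \dot p=-H_x(x,p,t),\qquad x|_{t=0}=x_0,\qquad p|_{t=0}=\nabla S_0(x_0)$$ has a solution $(x(t,x_0),p(t,x_0))$ for $t\in[0,T]$, and that for every $t\in[0,T]$ the map $x_0\mapsto x(t,x_0)$ is a $C^1$-diffeomorphism of $\mathbb R^N$ onto itself, with inverse $x\mapsto x_0(t,x)$. Put $$\mathcal S(t,x_0)=S_0(x_0)+\int_0^t L\big(x(s,x_0),\dot x(s,x_0),s\big)\,ds,\qquad S(t,x)=\mathcal S(t,x_0(t,x)).$$ Then $S\in C^1([0,T]\times\mathbb R^N)$,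 $S$ solves the Cauchy problem $$-\partial_t S(t,x)=H(x,\nabla S(t,x),t)\quad\text{for }(t,x)\in[0,T]\times\mathbb R^N,\qquad S(0,x)=S_0(x)\quad\text{for }x\in\mathbb R^N$$ (with one-sided time derivatives at $t=0$ and $t=T$), and it is the only solution of this problem in $C^1([0,T]\times\mathbb R^N)$. -/

import Mathlib

open Set
open scoped Manifold

noncomputable section

namespace HamiltonJacobi

/-- The configuration space `ℝ^N`, identified with its dual by the inner product. -/
abbrev Conf (N : ℕ) : Type := EuclideanSpace ℝ (Fin N)

/-- The extended phase space `ℝ^N × ℝ^N × ℝ`. -/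
abbrev ExtPhase (N : ℕ) : Type := Conf N × Conf N × ℝ

/-- `f` is a `C¹`-diffeomorphism of the normed space `E` onto the normed space `F`. -/
def IsC1Diffeo {E F : Type*} [NormedAddCommGroup E] [NormedSpace ℝ E]
    [NormedAddCommGroup F] [NormedSpace ℝ F] (f : E → F) : Prop :=
  ∃ Φ : Diffeomorph 𝓘(ℝ, E) 𝓘(ℝ, F) E F 1, ∀ z, Φ z = f z

variable {N : ℕ}

/-- The Legendre map `(x, v, t) ↦ (x, L_v(x, v, t), t)`. -/
def legendreMap (L : ExtPhase N → ℝ) (z : ExtPhase N) : ExtPhase N :=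
  (z.1, gradient (fun v => L (z.1, v, z.2.2)) z.2.1, z.2.2)

/-- The Hamilton function `H(x, p, t) = p · v - L(x, v, t)`, where `(x, v, t)` is the preimage
of `(x, p, t)` under the Legendre map (used only when that map is a bijection). -/
def hamiltonian (L : ExtPhase N → ℝ) (z : ExtPhase N) : ℝ :=
  inner ℝ z.2.1 (Function.invFun (legendreMap L) z).2.1 - L (Function.invFun (legendreMap L) z)

/-- `t ↦ (x t x₀, p t x₀)`, for every `x₀`, solves on `[0, T]` the Hamilton system
`x' = H_p`, `p' = -H_x` with initial data `x = x₀`, `p = ∇S₀(x₀)` at `t = 0`. -/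
structure IsHamiltonFlow (H : ExtPhase N → ℝ) (S₀ : Conf N → ℝ) (T : ℝ)
    (x p : ℝ → Conf N → Conf N) : Prop where
  position : ∀ x₀, ∀ t ∈ Icc 0 T,
    HasDerivWithinAt (fun s => x s x₀)
      (gradient (fun q => H (x t x₀, q, t)) (p t x₀)) (Icc 0 T) t
  momentum : ∀ x₀, ∀ t ∈ Icc 0 T,
    HasDerivWithinAt (fun s => p s x₀)
      (-gradient (fun y => H (y, p t x₀, t)) (x t x₀)) (Icc 0 T) t
  position_zero : ∀ x₀, x 0 x₀ = x₀
  momentum_zero : ∀ x₀, p 0 x₀ = gradient S₀ x₀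

/-- The action integral `S₀(x₀) + ∫₀ᵗ L(x(s,x₀), ẋ(s,x₀), s) ds` along the ray from `x₀`. -/
def rayAction (L : ExtPhase N → ℝ) (S₀ : Conf N → ℝ) (T : ℝ)
    (x : ℝ → Conf N → Conf N) (t : ℝ) (x₀ : Conf N) : ℝ :=
  S₀ x₀ + ∫ s in (0 : ℝ)..t, L (x s x₀, derivWithin (fun r => x r x₀) (Icc 0 T) s, s)

/-- The action as a function of time and the end point `y` of the ray: `x₀ = x₀(t, y)` is the
point with `x(t, x₀) = y` (used only when `x₀ ↦ x(t, x₀)` is a bijection). -/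
def action (L : ExtPhase N → ℝ) (S₀ : Conf N → ℝ) (T : ℝ)
    (x : ℝ → Conf N → Conf N) (t : ℝ) (y : Conf N) : ℝ :=
  rayAction L S₀ T x t (Function.invFun (x t) y)

/-- `S` is a classical (`C¹` up to the boundary times) solution on `[0, T] × ℝ^N` of
`-∂S/∂t = H(x, ∇S, t)`, `S|_{t=0} = S₀`; time derivatives at `0` and `T` are one-sided. -/
structure IsHJSolution (H : ExtPhase N → ℝ) (S₀ : Conf N → ℝ) (T : ℝ)
    (S : ℝ → Conf N → ℝ) : Prop where
  contDiffOn : ContDiffOn ℝ 1 (fun q : ℝ × Conf N => S q.1 q.2) (Icc 0 T ×ˢ univ)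
  equation : ∀ t ∈ Icc 0 T, ∀ y,
    -derivWithin (fun s => S s y) (Icc 0 T) t = H (y, gradient (S t) y, t)
  initial : ∀ y, S 0 y = S₀ y

end HamiltonJacobi

end


/-!
The Legendre transform makes `H` of class `C¹` with `H_p = v` and `H_x = -L_x`, so the rays solve
an ODE whose right-hand side is `C¹`. Their initial momenta `∇S₀(a)` need not be Lipschitz in `a`,
but `x(t, a) - a ≈ t v(a)` is locally Lipschitz for a small `t > 0`, hence so is the initial
velocity, and then the momentum. Gronwall's inequality makes the rays locally Lipschitz in `a`
uniformly in time, and `∂x/∂a` becomes continuous in `(t, a)`.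

By the Euler–Lagrange equation the action has the differential `d𝒮 = p dx - H dt` along the rays;
inverting the ray map gives `dS = p dx - H dt`, which is the Hamilton–Jacobi equation.

For uniqueness, let `W` be the difference along the rays between a second solution and the action.
Since `∂x/∂t = H_p`, the derivative `∂W/∂t` is only the second order Taylor remainder of `H` in the
difference of the two gradients. The gradients agree at a lowest point of the support of `W`, so
`|∂W/∂t| ≤ |∂W/∂a|` holds near that point, and such an inequality propagates zeros through backward
cones.
-/

open Metric Filter Topology Asymptotics

noncomputable section

namespace HamiltonJacobi

variable {N : ℕ}

section TimeIncrements

variable {A F : Type*} [NormedAddCommGroup F] [NormedSpace ℝ F]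
  {G : Type*} [SeminormedAddCommGroup G] [NormedSpace ℝ G]
  {g g' : ℝ → A → F} {h : A → G} {s : Set ℝ} {t₀ : ℝ} {l : Filter A}

theorem isBigOWith_increment_of_hasDerivWithinAt {c : ℝ} (hs : Convex ℝ s) (ht₀ : t₀ ∈ s)
    (hg : ∀ a, ∀ t ∈ s, HasDerivWithinAt (fun r => g r a) (g' t a) s t)
    (hg' : IsBigOWith c (𝓝[s] t₀ ×ˢ l) (fun q => g' q.1 q.2) fun q => h q.2) :
    IsBigOWith c (𝓝[s] t₀ ×ˢ l) (fun q => g q.1 q.2 - g t₀ q.2)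
      fun q => (q.1 - t₀) • h q.2 := by
  obtain ⟨P, hP, Q, hQ, hPQ⟩ := eventually_prod_iff.1 hg'.bound
  obtain ⟨δ, hδ, hball⟩ := Metric.mem_nhdsWithin_iff.1 hP
  refine IsBigOWith.of_bound (eventually_prod_iff.2 ⟨_, inter_mem (nhdsWithin_le_nhds
    (ball_mem_nhds t₀ hδ)) self_mem_nhdsWithin, Q, hQ, ?_⟩)
  rintro t ⟨htδ, hts⟩ a ha
  have hmean := ((convex_ball t₀ δ).inter hs).norm_image_sub_le_of_norm_hasDerivWithin_le
    (f := fun r => g r a) (f' := fun r => g' r a) (C := c * ‖h a‖)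
    (fun r hr => (hg a r hr.2).mono inter_subset_right) (fun r hr => hPQ (hball hr) ha)
    ⟨mem_ball_self hδ, ht₀⟩ ⟨htδ, hts⟩
  simpa only [norm_smul, mul_assoc, mul_comm, mul_left_comm] using hmean

theorem isBigO_increment_of_hasDerivWithinAt (hs : Convex ℝ s) (ht₀ : t₀ ∈ s)
    (hg : ∀ a, ∀ t ∈ s, HasDerivWithinAt (fun r => g r a) (g' t a) s t)
    (hg' : (fun q : ℝ × A => g' q.1 q.2) =O[𝓝[s] t₀ ×ˢ l] fun q => h q.2) :
    (fun q : ℝ × A => g q.1 q.2 - g t₀ q.2) =O[𝓝[s] t₀ ×ˢ l] fun q => (q.1 - t₀) • h q.2 :=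
  let ⟨_, hc⟩ := hg'.isBigOWith
  (isBigOWith_increment_of_hasDerivWithinAt hs ht₀ hg hc).isBigO

theorem isLittleO_increment_of_hasDerivWithinAt (hs : Convex ℝ s) (ht₀ : t₀ ∈ s)
    (hg : ∀ a, ∀ t ∈ s, HasDerivWithinAt (fun r => g r a) (g' t a) s t)
    (hg' : (fun q : ℝ × A => g' q.1 q.2) =o[𝓝[s] t₀ ×ˢ l] fun q => h q.2) :
    (fun q : ℝ × A => g q.1 q.2 - g t₀ q.2) =o[𝓝[s] t₀ ×ˢ l] fun q => (q.1 - t₀) • h q.2 :=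
  IsLittleO.of_isBigOWith fun _ hc =>
    isBigOWith_increment_of_hasDerivWithinAt hs ht₀ hg (hg'.forall_isBigOWith hc)

theorem hasFDerivWithinAt_uncurry [NormedAddCommGroup A] [NormedSpace ℝ A] {u u' : ℝ → A → F}
    (hs : Convex ℝ s) (ht₀ : t₀ ∈ s)
    (hu : ∀ a, ∀ t ∈ s, HasDerivWithinAt (fun r => u r a) (u' t a) s t) {a : A}
    (hu' : ContinuousWithinAt (fun q : ℝ × A => u' q.1 q.2) (s ×ˢ univ) (t₀, a))
    {D : A →L[ℝ] F} (hD : HasFDerivAt (u t₀) D a) :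
    HasFDerivWithinAt (fun q : ℝ × A => u q.1 q.2)
      ((ContinuousLinearMap.toSpanSingleton ℝ (u' t₀ a)).coprod D) (s ×ˢ univ) (t₀, a) := by
  have htime : (fun q : ℝ × A => u q.1 q.2 - u t₀ q.2 - (q.1 - t₀) • u' t₀ a)
      =o[𝓝[s ×ˢ univ] (t₀, a)] fun q => q - (t₀, a) := by
    have hsmall : (fun q : ℝ × A => u' q.1 q.2 - u' t₀ a) =o[𝓝[s] t₀ ×ˢ 𝓝 a]
        fun _ => (1 : ℝ) := by
      rw [isLittleO_one_iff, ← nhdsWithin_univ, ← nhdsWithin_prod_eq]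
      simpa using hu'.tendsto.sub_const (u' t₀ a)
    have := isLittleO_increment_of_hasDerivWithinAt (h := fun _ => (1 : ℝ)) hs ht₀
      (g := fun r b => u r b - r • u' t₀ a) (fun b t ht => by
        simpa only [one_smul] using
          (hu b t ht).fun_sub ((hasDerivAt_id' t).smul_const (u' t₀ a)).hasDerivWithinAt)
      hsmall
    rw [nhdsWithin_prod_eq, nhdsWithin_univ]
    refine (this.congr_left fun q => by rw [sub_smul]; abel).trans_isBigO
      (IsBigO.of_bound' (Eventually.of_forall fun q => ?_))
    simpa using norm_fst_le (q - (t₀, a))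
  have hspace : (fun q : ℝ × A => u t₀ q.2 - u t₀ a - D (q.2 - a))
      =o[𝓝[s ×ˢ univ] (t₀, a)] fun q => q - (t₀, a) :=
    ((hD.isLittleO.comp_tendsto
      (continuous_snd.tendsto (t₀, a))).mono nhdsWithin_le_nhds).trans_isBigO
      (IsBigO.of_bound' (Eventually.of_forall fun q => norm_snd_le (q - (t₀, a))))
  refine .of_isLittleO ((htime.add hspace).congr_left fun q => ?_)
  simp only [ContinuousLinearMap.coprod_apply, ContinuousLinearMap.toSpanSingleton_apply,
    Prod.fst_sub, Prod.snd_sub]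
  abel

end TimeIncrements

section Trajectories

theorem isBigO_sub_of_locallyLipschitz {E F : Type*} [SeminormedAddCommGroup E]
    [SeminormedAddCommGroup F] {g : E → F} (hg : LocallyLipschitz g) (x : E) :
    (fun q : E × E => g q.1 - g q.2) =O[𝓝 (x, x)] fun q => q.1 - q.2 := by
  obtain ⟨K, u, hu, hK⟩ := hg x
  refine IsBigO.of_bound K ?_
  filter_upwards [prod_mem_nhds hu hu] with q hq using hK.norm_sub_le hq.1 hq.2

theorem exists_lipschitzOnWith_closedBall {E : Type*} [SeminormedAddCommGroup E] [ProperSpace E]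
    {f : ℝ → E → E} (hf : LocallyLipschitz fun q : ℝ × E => f q.1 q.2) (T R : ℝ) :
    ∃ K, ∀ t ∈ Icc 0 T, LipschitzOnWith K (f t) (closedBall 0 R) := by
  obtain ⟨K, hK⟩ := (hf.locallyLipschitzOn).exists_lipschitzOnWith_of_compact
    (s := Icc 0 T ×ˢ closedBall 0 R) (isCompact_Icc.prod (isCompact_closedBall _ _))
  refine ⟨K, fun t ht => .of_dist_le_mul fun y hy w hw => ?_⟩
  simpa [Prod.dist_eq] using hK.dist_le_mul (t, y) ⟨ht, hy⟩ (t, w) ⟨ht, hw⟩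

variable {E : Type*} [NormedAddCommGroup E] [NormedSpace ℝ E] {f : ℝ → E → E} {T : ℝ}

theorem norm_sub_le_one_of_trajectories {u v : ℝ → E} {R : ℝ} {K : NNReal}
    (hf : ∀ t ∈ Icc 0 T, LipschitzOnWith K (f t) (closedBall 0 (R + 1)))
    (hu : ∀ t ∈ Icc 0 T, HasDerivWithinAt u (f t (u t)) (Icc 0 T) t)
    (hv : ∀ t ∈ Icc 0 T, HasDerivWithinAt v (f t (v t)) (Icc 0 T) t)
    (hR : ∀ t ∈ Icc 0 T, ‖u t‖ ≤ R) (h₀ : ‖v 0 - u 0‖ ≤ Real.exp ((K + 1) * (0 - T))) :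
    ∀ t ∈ Icc 0 T, ‖v t - u t‖ ≤ 1 := by
  have hderiv : ∀ t ∈ Icc 0 T, HasDerivWithinAt (fun s => v s - u s) (f t (v t) - f t (u t))
      (Icc 0 T) t := fun t ht => (hv t ht).sub (hu t ht)
  have hbarrier_le : ∀ t ≤ T, Real.exp ((K + 1) * (t - T)) ≤ 1 := fun t ht =>
    Real.exp_le_one_iff.2 (mul_nonpos_of_nonneg_of_nonpos (by positivity) (by linarith))
  have hbarrier : ∀ t ∈ Icc 0 T, ‖v t - u t‖ ≤ Real.exp ((K + 1) * (t - T)) := by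
    refine image_norm_le_of_norm_deriv_right_lt_deriv_boundary
      (B' := fun t => Real.exp ((K + 1) * (t - T)) * (K + 1))
      (fun t ht => (hderiv t ht).continuousWithinAt)
      (fun t ht => (hderiv t (Ico_subset_Icc_self ht)).mono_of_mem_nhdsWithin
        (Icc_mem_nhdsGE_of_mem ht))
      h₀ (fun t => ?_) (fun t ht heq => ?_)
    · simpa using (((hasDerivAt_id t).sub_const T).const_mul ((K : ℝ) + 1)).exp
    · have hu_mem : u t ∈ closedBall (0 : E) (R + 1) := by
        rw [mem_closedBall_zero_iff]; linarith [hR t (Ico_subset_Icc_self ht)]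
      have hv_mem : v t ∈ closedBall (0 : E) (R + 1) := by
        rw [mem_closedBall_zero_iff]
        linarith [norm_sub_norm_le (v t) (u t), hR t (Ico_subset_Icc_self ht),
          hbarrier_le t ht.2.le]
      have := (hf t (Ico_subset_Icc_self ht)).norm_sub_le hv_mem hu_mem
      linarith [Real.exp_pos ((K + 1) * (t - T)), heq ▸ this]
  exact fun t ht => (hbarrier t ht).trans (hbarrier_le t ht.2)

variable [ProperSpace E] {A : Type*} [TopologicalSpace A] {z : ℝ → A → E}

theorem exists_eventually_norm_le_of_trajectories
    (hf : LocallyLipschitz fun q : ℝ × E => f q.1 q.2)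
    (hz : ∀ a, ∀ t ∈ Icc 0 T, HasDerivWithinAt (fun s => z s a) (f t (z t a)) (Icc 0 T) t)
    (hz₀ : Continuous (z 0)) (a : A) :
    ∃ R, ∀ᶠ b in 𝓝 a, ∀ t ∈ Icc 0 T, ‖z t b‖ ≤ R := by
  obtain ⟨R, hR⟩ := isCompact_Icc.exists_bound_of_continuousOn
    fun t ht => (hz a t ht).continuousWithinAt
  obtain ⟨K, hK⟩ := exists_lipschitzOnWith_closedBall hf T (R + 1)
  have hclose : ∀ᶠ b in 𝓝 a, ‖z 0 b - z 0 a‖ < Real.exp ((K + 1) * (0 - T)) :=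
    ((hz₀.sub continuous_const).norm.tendsto' a 0 (by simp)).eventually_lt_const (Real.exp_pos _)
  refine ⟨R + 1, hclose.mono fun b hb t ht => ?_⟩
  have := norm_sub_le_one_of_trajectories hK (hz a) (hz b) hR hb.le t ht
  linarith [norm_sub_norm_le (z t b) (z t a), hR t ht]

theorem exists_eventually_norm_sub_le_of_trajectories
    (hf : LocallyLipschitz fun q : ℝ × E => f q.1 q.2)
    (hz : ∀ a, ∀ t ∈ Icc 0 T, HasDerivWithinAt (fun s => z s a) (f t (z t a)) (Icc 0 T) t)
    (hz₀ : Continuous (z 0)) (a : A) :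
    ∃ M, ∀ᶠ q in 𝓝 (a, a), ∀ t ∈ Icc 0 T, ‖z t q.1 - z t q.2‖ ≤ M * ‖z 0 q.1 - z 0 q.2‖ := by
  obtain ⟨R, hR⟩ := exists_eventually_norm_le_of_trajectories hf hz hz₀ a
  obtain ⟨K, hK⟩ := exists_lipschitzOnWith_closedBall hf T R
  have hright : ∀ b, ∀ t ∈ Ico 0 T, HasDerivWithinAt (fun s => z s b) (f t (z t b)) (Ici t) t :=
    fun b t ht => (hz b t (Ico_subset_Icc_self ht)).mono_of_mem_nhdsWithin
      (Icc_mem_nhdsGE_of_mem ht)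
  have hcont : ∀ b, ContinuousOn (fun s => z s b) (Icc 0 T) :=
    fun b t ht => (hz b t ht).continuousWithinAt
  refine ⟨Real.exp (K * (T - 0)), ?_⟩
  rw [nhds_prod_eq]
  filter_upwards [hR.prod_mk hR] with q hq t ht
  have hmem : ∀ b, (∀ t ∈ Icc 0 T, ‖z t b‖ ≤ R) → ∀ t ∈ Ico 0 T, z t b ∈ closedBall 0 R :=
    fun b hb t ht => mem_closedBall_zero_iff.2 (hb t (Ico_subset_Icc_self ht))
  have hgronwall := dist_le_of_trajectories_ODE_of_mem
    (fun t ht => hK t (Ico_subset_Icc_self ht)) (hcont q.1) (hright q.1) (hmem _ hq.1)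
    (hcont q.2) (hright q.2) (hmem _ hq.2) le_rfl t ht
  rw [← dist_eq_norm, ← dist_eq_norm, mul_comm]
  refine hgronwall.trans ?_
  gcongr
  exact ht.2

theorem continuousOn_uncurry_of_trajectories
    (hf : LocallyLipschitz fun q : ℝ × E => f q.1 q.2)
    (hz : ∀ a, ∀ t ∈ Icc 0 T, HasDerivWithinAt (fun s => z s a) (f t (z t a)) (Icc 0 T) t)
    (hz₀ : Continuous (z 0)) :
    ContinuousOn (fun q : ℝ × A => z q.1 q.2) (Icc 0 T ×ˢ univ) := by
  rintro ⟨t, a⟩ ⟨ht, -⟩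
  obtain ⟨M, hM⟩ := exists_eventually_norm_sub_le_of_trajectories hf hz hz₀ a
  rw [ContinuousWithinAt, nhdsWithin_prod_eq, nhdsWithin_univ]
  have htime : Tendsto (fun q : ℝ × A => z q.1 a) (𝓝[Icc 0 T] t ×ˢ 𝓝 a) (𝓝 (z t a)) :=
    (hz a t ht).continuousWithinAt.tendsto.comp tendsto_fst
  have hspace : Tendsto (fun q : ℝ × A => z q.1 q.2 - z q.1 a) (𝓝[Icc 0 T] t ×ˢ 𝓝 a) (𝓝 0) := by
    refine squeeze_zero_norm' (a := fun q => M * ‖z 0 q.2 - z 0 a‖) ?_ ?_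
    · have hM' : ∀ᶠ b in 𝓝 a, ∀ s ∈ Icc 0 T, ‖z s b - z s a‖ ≤ M * ‖z 0 b - z 0 a‖ :=
        (Continuous.tendsto (f := fun b => (b, a)) (by fun_prop) a).eventually hM
      filter_upwards [(eventually_mem_nhdsWithin (a := t) (s := Icc 0 T)).prod_mk hM']
        with q hq using hq.2 q.1 hq.1
    · refine Tendsto.comp (g := fun b => M * ‖z 0 b - z 0 a‖) ?_ tendsto_snd
      exact Continuous.tendsto' (by fun_prop) _ _ (by simp)
  simpa using hspace.add htime

theorem isBigO_sub_of_trajectories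
    (hf : LocallyLipschitz fun q : ℝ × E => f q.1 q.2)
    (hz : ∀ a, ∀ t ∈ Icc 0 T, HasDerivWithinAt (fun s => z s a) (f t (z t a)) (Icc 0 T) t)
    (hz₀ : Continuous (z 0)) (a : A) (t₀ : ℝ) :
    (fun q : ℝ × A × A => z q.1 q.2.1 - z q.1 q.2.2) =O[𝓝[Icc 0 T] t₀ ×ˢ 𝓝 (a, a)]
      fun q => z 0 q.2.1 - z 0 q.2.2 := by
  obtain ⟨M, hM⟩ := exists_eventually_norm_sub_le_of_trajectories hf hz hz₀ a
  refine IsBigO.of_bound M ?_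
  filter_upwards [(eventually_mem_nhdsWithin (a := t₀) (s := Icc 0 T)).prod_mk hM]
    with q hq using hq.2 q.1 hq.1

theorem tendsto_uncurry_pair_of_trajectories
    (hf : LocallyLipschitz fun q : ℝ × E => f q.1 q.2)
    (hz : ∀ a, ∀ t ∈ Icc 0 T, HasDerivWithinAt (fun s => z s a) (f t (z t a)) (Icc 0 T) t)
    (hz₀ : Continuous (z 0)) (a : A) {t₀ : ℝ} (ht₀ : t₀ ∈ Icc 0 T) :
    Tendsto (fun q : ℝ × A × A => ((q.1, z q.1 q.2.1), (q.1, z q.1 q.2.2)))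
      (𝓝[Icc 0 T] t₀ ×ˢ 𝓝 (a, a)) (𝓝 ((t₀, z t₀ a), (t₀, z t₀ a))) := by
  have hcont : Tendsto (fun q : ℝ × A => (q.1, z q.1 q.2)) (𝓝[Icc 0 T] t₀ ×ˢ 𝓝 a)
      (𝓝 (t₀, z t₀ a)) := by
    have := continuousOn_uncurry_of_trajectories hf hz hz₀ (t₀, a) ⟨ht₀, mem_univ a⟩
    rw [ContinuousWithinAt, nhdsWithin_prod_eq, nhdsWithin_univ] at this
    exact (tendsto_fst.mono_right nhdsWithin_le_nhds).prodMk_nhds this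
  rw [nhds_prod_eq (x := a)]
  exact (hcont.comp (tendsto_fst.prodMk (tendsto_fst.comp tendsto_snd))).prodMk_nhds
    (hcont.comp (tendsto_fst.prodMk (tendsto_snd.comp tendsto_snd)))

theorem isBigO_field_sub_of_trajectories
    (hf : LocallyLipschitz fun q : ℝ × E => f q.1 q.2)
    (hz : ∀ a, ∀ t ∈ Icc 0 T, HasDerivWithinAt (fun s => z s a) (f t (z t a)) (Icc 0 T) t)
    (hz₀ : Continuous (z 0)) (a : A) {t₀ : ℝ} (ht₀ : t₀ ∈ Icc 0 T) :
    (fun q : ℝ × A × A => f q.1 (z q.1 q.2.1) - f q.1 (z q.1 q.2.2))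
      =O[𝓝[Icc 0 T] t₀ ×ˢ 𝓝 (a, a)] fun q => z 0 q.2.1 - z 0 q.2.2 :=
  ((isBigO_sub_of_locallyLipschitz hf _).comp_tendsto
    (tendsto_uncurry_pair_of_trajectories hf hz hz₀ a ht₀)).trans
    ((isBigO_of_le _ (by simp)).trans (isBigO_sub_of_trajectories hf hz hz₀ a t₀))

theorem isLittleO_sub_sub_initial_of_trajectories (hT : 0 ≤ T)
    (hf : LocallyLipschitz fun q : ℝ × E => f q.1 q.2)
    (hz : ∀ a, ∀ t ∈ Icc 0 T, HasDerivWithinAt (fun s => z s a) (f t (z t a)) (Icc 0 T) t)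
    (hz₀ : Continuous (z 0)) (a : A) :
    (fun q : ℝ × A × A => z q.1 q.2.1 - z q.1 q.2.2 - (z 0 q.2.1 - z 0 q.2.2))
      =o[𝓝[Icc 0 T] 0 ×ˢ 𝓝 (a, a)] fun q => z 0 q.2.1 - z 0 q.2.2 := by
  have h0 : (0 : ℝ) ∈ Icc 0 T := left_mem_Icc.2 hT
  refine (isBigO_increment_of_hasDerivWithinAt (g := fun t q => z t q.1 - z t q.2)
    (g' := fun t q => f t (z t q.1) - f t (z t q.2)) (h := fun q : A × A => z 0 q.1 - z 0 q.2)
    (convex_Icc 0 T) h0 (fun q t ht => (hz q.1 t ht).sub (hz q.2 t ht))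
    (isBigO_field_sub_of_trajectories hf hz hz₀ a h0)).trans_isLittleO ?_
  have hsmall : (fun q : ℝ × A × A => q.1 - 0) =o[𝓝[Icc 0 T] 0 ×ˢ 𝓝 (a, a)]
      fun _ => (1 : ℝ) := by
    rw [isLittleO_one_iff]
    simpa using tendsto_fst.mono_right (nhdsWithin_le_nhds (s := Icc 0 T) (a := (0 : ℝ)))
  simpa using hsmall.smul_isBigO (isBigO_refl (fun q : ℝ × A × A => z 0 q.2.1 - z 0 q.2.2) _)

theorem isLittleO_field_sub_sub_initial_of_trajectories (hT : 0 ≤ T)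
    (hf : ContDiff ℝ 1 fun q : ℝ × E => f q.1 q.2)
    (hz : ∀ a, ∀ t ∈ Icc 0 T, HasDerivWithinAt (fun s => z s a) (f t (z t a)) (Icc 0 T) t)
    (hz₀ : Continuous (z 0)) (a : A) :
    (fun q : ℝ × A × A => f q.1 (z q.1 q.2.1) - f q.1 (z q.1 q.2.2)
        - (f 0 (z 0 q.2.1) - f 0 (z 0 q.2.2)))
      =o[𝓝[Icc 0 T] 0 ×ˢ 𝓝 (a, a)] fun q => z 0 q.2.1 - z 0 q.2.2 := by
  set l := 𝓝[Icc 0 T] (0 : ℝ) ×ˢ 𝓝 (a, a)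
  set D := fderiv ℝ (fun q : ℝ × E => f q.1 q.2) (0, z 0 a)
  have hstrict : HasStrictFDerivAt (fun q : ℝ × E => f q.1 q.2) D (0, z 0 a) :=
    hf.contDiffAt.hasStrictFDerivAt one_ne_zero
  have hlater : (fun q : ℝ × A × A => f q.1 (z q.1 q.2.1) - f q.1 (z q.1 q.2.2)
      - D ((q.1, z q.1 q.2.1) - (q.1, z q.1 q.2.2))) =o[l] fun q => z 0 q.2.1 - z 0 q.2.2 :=
    (hstrict.isLittleO.comp_tendsto (tendsto_uncurry_pair_of_trajectories hf.locallyLipschitz hz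
      hz₀ a (left_mem_Icc.2 hT))).trans_isBigO ((isBigO_of_le _ (by simp)).trans
        (isBigO_sub_of_trajectories hf.locallyLipschitz hz hz₀ a 0))
  have hinitial : (fun q : ℝ × A × A => f 0 (z 0 q.2.1) - f 0 (z 0 q.2.2)
      - D ((0, z 0 q.2.1) - (0, z 0 q.2.2))) =o[l] fun q => z 0 q.2.1 - z 0 q.2.2 := by
    have hlim : Tendsto (fun q : A × A => (((0 : ℝ), z 0 q.1), ((0 : ℝ), z 0 q.2))) (𝓝 (a, a))
        (𝓝 ((0, z 0 a), (0, z 0 a))) := Continuous.tendsto (by fun_prop) (a, a)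
    exact (hstrict.isLittleO.comp_tendsto (hlim.comp tendsto_snd)).trans_isBigO
      (isBigO_of_le _ (by simp))
  have hlinear : (fun q : ℝ × A × A => D (0, z q.1 q.2.1 - z q.1 q.2.2
      - (z 0 q.2.1 - z 0 q.2.2))) =o[l] fun q => z 0 q.2.1 - z 0 q.2.2 :=
    ((D.comp (.inr ℝ ℝ E)).isBigO_comp _ l).trans_isLittleO
      (isLittleO_sub_sub_initial_of_trajectories hT hf.locallyLipschitz hz hz₀ a)
  refine ((hlater.sub hinitial).add hlinear).congr_left fun q => ?_
  have hD : D (0, z q.1 q.2.1 - z q.1 q.2.2 - (z 0 q.2.1 - z 0 q.2.2))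
      = D ((q.1, z q.1 q.2.1) - (q.1, z q.1 q.2.2)) - D ((0, z 0 q.2.1) - (0, z 0 q.2.2)) := by
    rw [← map_sub]; simp
  rw [hD]
  abel

theorem isLittleO_sub_of_trajectories (hT : 0 ≤ T)
    (hf : ContDiff ℝ 1 fun q : ℝ × E => f q.1 q.2)
    (hz : ∀ a, ∀ t ∈ Icc 0 T, HasDerivWithinAt (fun s => z s a) (f t (z t a)) (Icc 0 T) t)
    (hz₀ : Continuous (z 0)) (a : A) :
    (fun q : ℝ × A × A => z q.1 q.2.1 - z q.1 q.2.2 - (z 0 q.2.1 - z 0 q.2.2)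
        - q.1 • (f 0 (z 0 q.2.1) - f 0 (z 0 q.2.2)))
      =o[𝓝[Icc 0 T] 0 ×ˢ 𝓝 (a, a)] fun q => q.1 • (z 0 q.2.1 - z 0 q.2.2) := by
  have := isLittleO_increment_of_hasDerivWithinAt (h := fun q : A × A => z 0 q.1 - z 0 q.2)
    (g := fun t q => z t q.1 - z t q.2 - t • (f 0 (z 0 q.1) - f 0 (z 0 q.2)))
    (convex_Icc 0 T) (left_mem_Icc.2 hT)
    (fun q t ht => by
      simpa only [one_smul] using ((hz q.1 t ht).fun_sub (hz q.2 t ht)).fun_sub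
        ((hasDerivAt_id' t).smul_const (f 0 (z 0 q.1) - f 0 (z 0 q.2))).hasDerivWithinAt)
    (isLittleO_field_sub_sub_initial_of_trajectories hT hf hz hz₀ a)
  refine this.congr (fun q => ?_) fun q => by simp only [sub_zero]
  simp only [zero_smul, sub_zero]
  abel

end Trajectories

section Integration

variable {A F G : Type*} [NormedAddCommGroup F] [NormedSpace ℝ F] [SeminormedAddCommGroup G]
  {l : Filter A} {h : A → G}

theorem isLittleO_sub_of_hasDerivWithinAt {g g' : ℝ → A → F} {s : Set ℝ} (hs : Convex ℝ s)
    (hs' : IsCompact s) (hg : ∀ a, ∀ t ∈ s, HasDerivWithinAt (fun r => g r a) (g' t a) s t)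
    (hg' : ∀ t ∈ s, (fun q : ℝ × A => g' q.1 q.2) =o[𝓝[s] t ×ˢ l] fun q => h q.2)
    {t₀ t₁ : ℝ} (ht₀ : t₀ ∈ s) (ht₁ : t₁ ∈ s) : (fun a => g t₁ a - g t₀ a) =o[l] h := by
  refine isLittleO_iff.2 fun ε hε => ?_
  set c := ε / (‖t₁ - t₀‖ + 1)
  have hc : 0 < c := by positivity
  have hbound : ∀ᶠ a in l, ∀ t ∈ s, ‖g' t a‖ ≤ c * ‖h a‖ := by
    refine hs'.induction_on (p := fun u => ∀ᶠ a in l, ∀ t ∈ u, ‖g' t a‖ ≤ c * ‖h a‖)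
      (by simp) (fun u v huv hv => hv.mono fun a ha t ht => ha t (huv ht))
      (fun u v hu hv => ?_) fun t ht => ?_
    · filter_upwards [hu, hv] with a hau hav t ht using ht.elim (hau t) (hav t)
    · obtain ⟨P, hP, Q, hQ, hPQ⟩ := eventually_prod_iff.1 ((hg' t ht).def hc)
      exact ⟨{r | P r}, hP, hQ.mono fun a ha r hr => hPQ hr ha⟩
  filter_upwards [hbound] with a ha
  calc ‖g t₁ a - g t₀ a‖ ≤ c * ‖h a‖ * ‖t₁ - t₀‖ :=
        hs.norm_image_sub_le_of_norm_hasDerivWithin_le (hg a) ha ht₀ ht₁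
    _ ≤ c * ‖h a‖ * (‖t₁ - t₀‖ + 1) := by gcongr; linarith
    _ = ε * ‖h a‖ := by simp only [c]; field_simp

-- Evaluating the expansion `X t = d + t • v + o(t • h)` at one small time `t > 0` bounds `v` by
-- `d` and a small multiple of `h`.
theorem isBigO_of_isLittleO_smul [NormedSpace ℝ G] {T : ℝ} (hT : 0 < T) {X : ℝ → A → F}
    {d v : A → F} (hX : ∀ t ∈ Icc 0 T, X t =O[l] d)
    (hexp : (fun q : ℝ × A => X q.1 q.2 - d q.2 - q.1 • v q.2)
      =o[𝓝[Icc 0 T] 0 ×ˢ l] fun q => q.1 • h q.2)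
    (hh : h =O[l] fun a => (d a, v a)) : h =O[l] d := by
  obtain ⟨C, hC, hhC⟩ := hh.exists_pos
  have hsmall : ∀ᶠ t in 𝓝[Ioc 0 T] (0 : ℝ), ∀ᶠ a in l,
      ‖X t a - d a - t • v a‖ ≤ 1 / (2 * C) * ‖t • h a‖ :=
    (hexp.def (by positivity)).curry.filter_mono (nhdsWithin_mono 0 Ioc_subset_Icc_self)
  have hne : (𝓝[Ioc 0 T] (0 : ℝ)).NeBot := by
    rw [nhdsWithin_Ioc_eq_nhdsGT hT]; infer_instance
  obtain ⟨t, ht, ⟨ht₀, htT⟩⟩ := (hsmall.and self_mem_nhdsWithin).exists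
  obtain ⟨K, hK⟩ := (hX t ⟨ht₀.le, htT⟩).bound
  refine hh.trans ((isBigO_refl d l).prod_left (.of_bound (2 * (K + 1) / t + 1) ?_))
  filter_upwards [ht, hK, hhC.bound] with a hexp hXd hhdv
  have hnorm : ‖(d a, v a)‖ ≤ ‖d a‖ + ‖v a‖ := max_le_add_of_nonneg (norm_nonneg _) (norm_nonneg _)
  rw [norm_smul, Real.norm_of_nonneg ht₀.le] at hexp
  have hrem : 1 / (2 * C) * (t * ‖h a‖) ≤ t * (‖d a‖ + ‖v a‖) / 2 := by
    calc 1 / (2 * C) * (t * ‖h a‖) ≤ 1 / (2 * C) * (t * (C * (‖d a‖ + ‖v a‖))) := by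
          gcongr; exact hhdv.trans (by gcongr)
      _ = t * (‖d a‖ + ‖v a‖) / 2 := by field_simp
  have hvel : t * ‖v a‖ ≤ K * ‖d a‖ + ‖d a‖ + t * (‖d a‖ + ‖v a‖) / 2 := by
    calc t * ‖v a‖ = ‖X t a - d a - (X t a - d a - t • v a)‖ := by
          rw [sub_sub_cancel, norm_smul, Real.norm_of_nonneg ht₀.le]
      _ ≤ ‖X t a‖ + ‖d a‖ + ‖X t a - d a - t • v a‖ :=
        (norm_sub_le _ _).trans (by gcongr; exact norm_sub_le _ _)
      _ ≤ _ := by gcongr; exact hexp.trans hrem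
  calc ‖v a‖ = t * ‖v a‖ / t := by field_simp
    _ ≤ (2 * (K + 1) * ‖d a‖ + t * ‖d a‖) / t := by gcongr; linarith
    _ = (2 * (K + 1) / t + 1) * ‖d a‖ := by field_simp

end Integration

section ParametricStrictDerivative

variable {ι E F : Type*} [NormedAddCommGroup E] [NormedSpace ℝ E]
  [NormedAddCommGroup F] [NormedSpace ℝ F] {l : Filter ι} {X : ι → E → F} {a : E}

theorem exists_eventually_approximatesLinearOn {A : E →L[ℝ] F}
    (hX : (fun q : ι × E × E => X q.1 q.2.1 - X q.1 q.2.2 - A (q.2.1 - q.2.2))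
      =o[l ×ˢ 𝓝 (a, a)] fun q => q.2.1 - q.2.2) {c : NNReal} (hc : 0 < c) :
    ∃ u ∈ 𝓝 a, ∀ᶠ i in l, ApproximatesLinearOn (X i) A u c := by
  obtain ⟨P, hP, Q, hQ, hPQ⟩ := eventually_prod_iff.1 (hX.def hc)
  obtain ⟨u, hu, huQ⟩ := mem_prod_same_iff.1 (by rwa [nhds_prod_eq] at hQ)
  exact ⟨u, hu, hP.mono fun i hi b hb b' hb' => hPQ hi (huQ (mk_mem_prod hb hb'))⟩

theorem tendsto_fderiv_of_isLittleO {A : E →L[ℝ] F} {X' : ι → E → E →L[ℝ] F}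
    (hX : (fun q : ι × E × E => X q.1 q.2.1 - X q.1 q.2.2 - A (q.2.1 - q.2.2))
      =o[l ×ˢ 𝓝 (a, a)] fun q => q.2.1 - q.2.2)
    (hX' : ∀ᶠ i in l, ∀ b, HasFDerivAt (X i) (X' i b) b) :
    Tendsto (fun q : ι × E => X' q.1 q.2) (l ×ˢ 𝓝 a) (𝓝 A) := by
  refine Metric.tendsto_nhds.2 fun ε hε => ?_
  lift ε to NNReal using hε.le
  have hε' : 0 < ε / 2 := half_pos (NNReal.coe_pos.1 hε)
  obtain ⟨u, hu, hXu⟩ := exists_eventually_approximatesLinearOn hX hε'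
  filter_upwards [(hXu.and hX').prod_mk (eventually_mem_nhds_iff.2 hu)] with q ⟨⟨hq, hq'⟩, hqu⟩
  rw [dist_eq_norm]
  exact (((hq' q.2).sub A.hasFDerivAt).le_of_lipschitzOn hqu hq.lipschitzOnWith).trans_lt
    (NNReal.half_lt_self (NNReal.coe_pos.1 hε).ne')

theorem tendsto_inverse_of_isLittleO [CompleteSpace E] {A : E ≃L[ℝ] F} {Y : ι → F → E} {y₀ : F}
    (hX : (fun q : ι × E × E => X q.1 q.2.1 - X q.1 q.2.2 - A (q.2.1 - q.2.2))
      =o[l ×ˢ 𝓝 (a, a)] fun q => q.2.1 - q.2.2)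
    (hY : ∀ᶠ i in l, Function.LeftInverse (Y i) (X i)) (hXa : Tendsto (X · a) l (𝓝 y₀)) :
    Tendsto (fun q : ι × F => Y q.1 q.2) (l ×ˢ 𝓝 y₀) (𝓝 a) := by
  let B : (A : E →L[ℝ] F).NonlinearRightInverse :=
    { A.toNonlinearRightInverse with
      nnnorm := ‖(A.symm : F →L[ℝ] E)‖₊ + 1
      bound' := fun y => (A.toNonlinearRightInverse.bound y).trans <| by
        gcongr; exact le_self_add }
  have hB : 0 < B.nnnorm⁻¹ := inv_pos.2 (by positivity)
  obtain ⟨u, hu, hXu⟩ := exists_eventually_approximatesLinearOn (A := (A : E →L[ℝ] F)) hX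
    (half_pos hB)
  refine Metric.tendsto_nhds.2 fun ε hε => ?_
  obtain ⟨r, hr, hru⟩ := Metric.nhds_basis_closedBall.mem_iff.1 hu
  set ρ := min r (ε / 2)
  have hρ : 0 < ρ := by positivity
  have hnear : ∀ᶠ q : ι × F in l ×ˢ 𝓝 y₀,
      dist q.2 (X q.1 a) < ((B.nnnorm : ℝ)⁻¹ - (B.nnnorm⁻¹ / 2 : NNReal)) * ρ := by
    have : Tendsto (fun q : ι × F => dist q.2 (X q.1 a)) (l ×ˢ 𝓝 y₀) (𝓝 (dist y₀ y₀)) :=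
      tendsto_snd.dist (hXa.comp tendsto_fst)
    rw [dist_self] at this
    refine this.eventually_lt_const (mul_pos ?_ hρ)
    push_cast
    linarith [show 0 < (B.nnnorm : ℝ)⁻¹ by exact_mod_cast hB]
  filter_upwards [hnear, (hXu.and hY).prod_inl (𝓝 y₀)] with q hq ⟨hq₁, hq₂⟩
  obtain ⟨b, hb, hbq⟩ := hq₁.surjOn_closedBall_of_nonlinearRightInverse B hρ.le
    ((closedBall_subset_closedBall (min_le_left _ _)).trans hru) (mem_closedBall.2 hq.le)
  rw [← hbq, hq₂ b]
  exact (mem_closedBall.1 hb).trans_lt ((min_le_right _ _).trans_lt (half_lt_self hε))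

theorem exists_eventually_norm_le_norm_comp {G : Type*} [NormedAddCommGroup G] [NormedSpace ℝ G]
    {A : E ≃L[ℝ] F} {D : ι → E →L[ℝ] F} (hD : Tendsto D l (𝓝 (A : E →L[ℝ] F))) :
    ∃ C, ∀ᶠ i in l, ∀ φ : F →L[ℝ] G, ‖φ‖ ≤ C * ‖φ.comp (D i)‖ := by
  set m := ‖(A.symm : F →L[ℝ] E)‖
  have hclose : ∀ᶠ i in l, ‖(D i - A).comp (A.symm : F →L[ℝ] E)‖ < 1 / 2 := by
    have hcont : Continuous fun B : E →L[ℝ] F => ‖(B - A).comp (A.symm : F →L[ℝ] E)‖ := by fun_prop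
    exact ((hcont.tendsto' A 0 (by simp)).comp hD).eventually_lt_const (by norm_num)
  refine ⟨2 * m, hclose.mono fun i hi φ => ?_⟩
  have hsplit : φ = (φ.comp (D i)).comp (A.symm : F →L[ℝ] E)
      - φ.comp ((D i - A).comp (A.symm : F →L[ℝ] E)) := by
    ext y; simp
  have := calc ‖φ‖ ≤ ‖(φ.comp (D i)).comp (A.symm : F →L[ℝ] E)‖
        + ‖φ.comp ((D i - A).comp (A.symm : F →L[ℝ] E))‖ :=
        (congrArg norm hsplit).trans_le (norm_sub_le _ _)
    _ ≤ ‖φ.comp (D i)‖ * m + ‖φ‖ * (1 / 2) := by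
        gcongr
        · exact ContinuousLinearMap.opNorm_comp_le _ _
        · exact (ContinuousLinearMap.opNorm_comp_le _ _).trans (by gcongr)
  linarith

end ParametricStrictDerivative

section FiniteSpeed

variable {E : Type*} [NormedAddCommGroup E]

/-- The backward cone with apex `(t₁, a₁)`, opening speed `c` and base at time `t₀`. -/
def backwardCone (c t₀ t₁ : ℝ) (a₁ : E) : Set (ℝ × E) :=
  {q | q.1 ∈ Icc t₀ t₁ ∧ ‖q.2 - a₁‖ ≤ c * (t₁ - q.1)}

variable {c t₀ t₁ T : ℝ} {a₁ : E}

theorem isCompact_backwardCone [ProperSpace E] (hc : 0 ≤ c) :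
    IsCompact (backwardCone c t₀ t₁ a₁) := by
  refine ((isCompact_Icc (a := t₀) (b := t₁)).prod
    (isCompact_closedBall a₁ (c * (t₁ - t₀)))).of_isClosed_subset ?_ ?_
  · exact (isClosed_Icc.preimage continuous_fst).inter
      (isClosed_le (f := fun q : ℝ × E => ‖q.2 - a₁‖) (g := fun q => c * (t₁ - q.1))
        (by fun_prop) (by fun_prop))
  · rintro q ⟨hq, hq'⟩
    refine ⟨hq, mem_closedBall_iff_norm.2 (hq'.trans ?_)⟩
    gcongr
    exact hq.1

variable [NormedSpace ℝ E]

theorem segment_subset_backwardCone (hc : 0 ≤ c) {q : ℝ × E} (hq : q ∈ backwardCone c t₀ t₁ a₁)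
    {e : E} (he : ‖e‖ ≤ 1) :
    segment ℝ q (q + (q.1 - t₀) • (-1, c • e)) ⊆ backwardCone c t₀ t₁ a₁ := by
  rw [segment_eq_image']
  rintro _ ⟨θ, ⟨hθ₀, hθ₁⟩, rfl⟩
  obtain ⟨⟨ht₀, ht₁⟩, hnorm⟩ := hq
  have htime : θ * (q.1 - t₀) ≤ q.1 - t₀ := mul_le_of_le_one_left (by linarith) hθ₁
  have htime₀ : 0 ≤ θ * (q.1 - t₀) := mul_nonneg hθ₀ (by linarith)
  simp only [backwardCone, mem_ofPred_eq, add_sub_cancel_left, Prod.fst_add, Prod.snd_add,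
    Prod.smul_fst, Prod.smul_snd, smul_smul, smul_eq_mul, mul_neg, mul_one]
  refine ⟨⟨by linarith, by linarith⟩, ?_⟩
  calc ‖q.2 + (θ * (q.1 - t₀) * c) • e - a₁‖
      ≤ ‖q.2 - a₁‖ + ‖(θ * (q.1 - t₀) * c) • e‖ := by
        rw [add_sub_right_comm]; exact norm_add_le _ _
    _ ≤ c * (t₁ - q.1) + θ * (q.1 - t₀) * c * 1 := by
        rw [norm_smul, Real.norm_of_nonneg (by positivity)]
        gcongr
    _ = c * (t₁ - (q.1 + -(θ * (q.1 - t₀)))) := by ring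

variable {W : ℝ × E → ℝ} {W' : ℝ × E → ℝ × E →L[ℝ] ℝ}

theorem mul_norm_comp_inr_le_of_isMaxOn (hc : 0 ≤ c) {ε : ℝ} {q : ℝ × E}
    (hq : q ∈ backwardCone c t₀ t₁ a₁) (hqt : t₀ < q.1)
    (hW : HasFDerivWithinAt W (W' q) (backwardCone c t₀ t₁ a₁) q)
    (hmax : IsMaxOn (fun r => W r - ε * r.1) (backwardCone c t₀ t₁ a₁) q) :
    c * ‖(W' q).comp (.inr ℝ ℝ E)‖ ≤ W' q (1, 0) - ε := by
  have hdescend : ∀ e : E, ‖e‖ ≤ 1 → c * W' q (0, e) ≤ W' q (1, 0) - ε := by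
    intro e he
    have hderiv : HasFDerivWithinAt (fun r : ℝ × E => W r - ε * r.1)
        (W' q - ε • ContinuousLinearMap.fst ℝ ℝ E) (backwardCone c t₀ t₁ a₁) q :=
      hW.sub (hasFDerivAt_fst.hasFDerivWithinAt.const_mul ε)
    have hle := hmax.localize.hasFDerivWithinAt_nonpos hderiv
      (mem_posTangentConeAt_of_segment_subset (segment_subset_backwardCone hc hq he))
    have hsplit : W' q (-1, c • e) = c * W' q (0, e) - W' q (1, 0) := by
      rw [← smul_eq_mul, ← map_smul, ← map_sub]; simp
    simp only [map_smul, sub_apply, smul_apply,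
      ContinuousLinearMap.coe_fst', smul_eq_mul, hsplit] at hle
    nlinarith [sub_pos.2 hqt]
  rw [← Real.norm_of_nonneg hc, ← norm_smul]
  refine ContinuousLinearMap.opNorm_le_of_unit_norm ?_ fun e he => ?_
  · simpa [Prod.mk_zero_zero] using hdescend 0 (by simp)
  · refine abs_le.2 ⟨?_, by simpa using hdescend e he.le⟩
    have := hdescend (-e) (by rw [norm_neg, he])
    rw [show ((0 : ℝ), -e) = -(0, e) by simp, map_neg] at this
    simp only [smul_apply, ContinuousLinearMap.comp_apply,
      ContinuousLinearMap.inr_apply, smul_eq_mul]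
    linarith

theorem nonpos_of_backwardCone [ProperSpace E] (hc : 0 ≤ c) (ht : t₀ ≤ t₁)
    (hW : ∀ q ∈ backwardCone c t₀ t₁ a₁,
      HasFDerivWithinAt W (W' q) (backwardCone c t₀ t₁ a₁) q)
    (hspeed : ∀ q ∈ backwardCone c t₀ t₁ a₁, |W' q (1, 0)| ≤ c * ‖(W' q).comp (.inr ℝ ℝ E)‖)
    (hbase : ∀ q ∈ backwardCone c t₀ t₁ a₁, q.1 = t₀ → W q = 0) : W (t₁, a₁) ≤ 0 := by
  by_contra! hpos
  have hapex : (t₁, a₁) ∈ backwardCone c t₀ t₁ a₁ := by simp [backwardCone, ht]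
  set ε := W (t₁, a₁) / (2 * (t₁ - t₀ + 1))
  have hε : 0 < ε := div_pos hpos (by linarith)
  have hεW : ε * (t₁ - t₀) < W (t₁, a₁) := by
    calc ε * (t₁ - t₀) < ε * (2 * (t₁ - t₀ + 1)) := by gcongr; linarith
      _ = W (t₁, a₁) := div_mul_cancel₀ _ (by linarith)
  have hcont : ContinuousOn (fun r => W r - ε * r.1) (backwardCone c t₀ t₁ a₁) :=
    ContinuousOn.sub (fun q hq => (hW q hq).continuousWithinAt) (by fun_prop)
  obtain ⟨q, hq, hmax⟩ := (isCompact_backwardCone hc).exists_isMaxOn ⟨_, hapex⟩ hcont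
  have hqt : t₀ < q.1 := by
    refine hq.1.1.lt_of_ne fun heq => ?_
    have : W (t₁, a₁) - ε * t₁ ≤ W q - ε * q.1 := hmax hapex
    rw [hbase q hq heq.symm, ← heq] at this
    linarith
  linarith [mul_norm_comp_inr_le_of_isMaxOn hc hq hqt (hW q hq) hmax, hspeed q hq,
    le_abs_self (W' q (1, 0))]

theorem eq_zero_of_backwardCone [ProperSpace E] (hc : 0 ≤ c) (ht : t₀ ≤ t₁)
    (hW : ∀ q ∈ backwardCone c t₀ t₁ a₁,
      HasFDerivWithinAt W (W' q) (backwardCone c t₀ t₁ a₁) q)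
    (hspeed : ∀ q ∈ backwardCone c t₀ t₁ a₁, |W' q (1, 0)| ≤ c * ‖(W' q).comp (.inr ℝ ℝ E)‖)
    (hbase : ∀ q ∈ backwardCone c t₀ t₁ a₁, q.1 = t₀ → W q = 0) : W (t₁, a₁) = 0 := by
  refine (nonpos_of_backwardCone hc ht hW hspeed hbase).antisymm ?_
  have := nonpos_of_backwardCone (W := -W) (W' := -W') hc ht (fun q hq => (hW q hq).neg)
    (fun q hq => ?_) fun q hq hqt => by simp [hbase q hq hqt]
  · simpa using this
  · simpa only [Pi.neg_apply, neg_apply, abs_neg,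
      ContinuousLinearMap.neg_comp, norm_neg] using hspeed q hq

theorem eventually_eq_zero_of_finite_speed [ProperSpace E] (hc : 0 ≤ c)
    (hW : ∀ q ∈ Icc 0 T ×ˢ univ, HasFDerivWithinAt W (W' q) (Icc 0 T ×ˢ univ) q)
    (h₀ : ∀ a, W (0, a) = 0) {a₀ : E}
    (hspeed : ∀ᶠ q in 𝓝[Icc 0 T ×ˢ univ] (t₀, a₀),
      |W' q (1, 0)| ≤ c * ‖(W' q).comp (.inr ℝ ℝ E)‖)
    (hzero : ∀ q ∈ Icc 0 T ×ˢ univ,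
      (c + 1) * q.1 + ‖q.2 - a₁‖ < (c + 1) * t₀ + ‖a₀ - a₁‖ → W q = 0) :
    ∀ᶠ q in 𝓝[Icc 0 T ×ˢ univ] (t₀, a₀), W q = 0 := by
  obtain ⟨ρ, hρ, hball⟩ := Metric.mem_nhdsWithin_iff.1 hspeed
  set k := ρ / (2 * (c + 1))
  have hk : (c + 1) * k = ρ / 2 := by simp only [k]; field_simp
  have hk₀ : 0 < k := by positivity
  set r := k / (2 * (c + 2))
  have hr : (c + 2) * r = k / 2 := by simp only [r]; field_simp
  have hr₀ : 0 < r := by positivity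
  filter_upwards [self_mem_nhdsWithin, nhdsWithin_le_nhds (ball_mem_nhds (t₀, a₀) hr₀)]
    with ⟨t, a⟩ ⟨⟨ht0, htT⟩, _⟩ hnear
  obtain ⟨htr, har⟩ : |t - t₀| < r ∧ ‖a - a₀‖ < r := by
    simpa [Prod.dist_eq, Real.dist_eq, dist_eq_norm] using hnear
  obtain ⟨htr₁, htr₂⟩ := abs_lt.1 htr
  have hcone : ∀ q ∈ backwardCone c (max 0 (t - k)) t a,
      q ∈ Icc 0 T ×ˢ univ ∧ t - k ≤ q.1 ∧ ‖q.2 - a₀‖ ≤ c * k + r := by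
    rintro q ⟨⟨hqs, hqt⟩, hqa⟩
    have hqk := (le_max_right _ _).trans hqs
    refine ⟨⟨⟨(le_max_left _ _).trans hqs, hqt.trans htT⟩, mem_univ _⟩, hqk, ?_⟩
    calc ‖q.2 - a₀‖ ≤ ‖q.2 - a‖ + ‖a - a₀‖ := norm_sub_le_norm_sub_add_norm_sub _ _ _
      _ ≤ c * k + r := add_le_add (hqa.trans (by gcongr; linarith)) har.le
  refine eq_zero_of_backwardCone hc (max_le ht0 (by linarith))
    (fun q hq => (hW q (hcone q hq).1).mono fun q' hq' => (hcone q' hq').1)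
    (fun q hq => hball ⟨?_, (hcone q hq).1⟩) fun q hq hqs => ?_
  · obtain ⟨-, hqk, hqa⟩ := hcone q hq
    rw [mem_ball, Prod.dist_eq, max_lt_iff, Real.dist_eq, dist_eq_norm, abs_lt]
    refine ⟨⟨?_, ?_⟩, ?_⟩ <;> nlinarith [hq.1.2]
  · rcases le_total (t - k) 0 with hle | hle
    · rw [max_eq_left hle] at hqs
      rw [← Prod.mk.eta (p := q), hqs, h₀]
    · rw [max_eq_right hle] at hqs
      obtain ⟨hqI, -, hqa⟩ := hcone q hq
      refine hzero q hqI ?_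
      rw [hqs]
      nlinarith [norm_sub_le_norm_sub_add_norm_sub q.2 a₀ a₁]

-- At a point of the support of `W` that is lowest with respect to a tilted time, the hypothesis
-- grants the speed bound, and nearby backward cones start where `W` is already known to vanish.
theorem eq_zero_of_finite_speed [ProperSpace E] (hc : 0 ≤ c)
    (hW : ∀ q ∈ Icc 0 T ×ˢ univ, HasFDerivWithinAt W (W' q) (Icc 0 T ×ˢ univ) q)
    (h₀ : ∀ a, W (0, a) = 0)
    (hspeed : ∀ t₀ ∈ Icc 0 T, ∀ a₀, (∀ t ∈ Ico 0 t₀, ∀ᶠ a in 𝓝 a₀, W (t, a) = 0) →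
      ∀ᶠ q in 𝓝[Icc 0 T ×ˢ univ] (t₀, a₀), |W' q (1, 0)| ≤ c * ‖(W' q).comp (.inr ℝ ℝ E)‖) :
    ∀ q ∈ Icc 0 T ×ˢ univ, W q = 0 := by
  rintro ⟨t₁, a₁⟩ ⟨ht₁, -⟩
  by_contra hne
  set S := {q ∈ Icc 0 T ×ˢ univ | W q ≠ 0}
  set K := closure S ∩ Icc 0 T ×ˢ closedBall a₁ ((c + 1) * T)
  have hK : IsCompact K := (isCompact_Icc.prod (isCompact_closedBall _ _)).inter_left
    isClosed_closure
  have hT : 0 ≤ T := ht₁.1.trans ht₁.2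
  have hmem : (t₁, a₁) ∈ K := ⟨subset_closure ⟨⟨ht₁, mem_univ _⟩, hne⟩, ht₁,
    mem_closedBall_self (by positivity)⟩
  obtain ⟨⟨t₀, a₀⟩, ⟨hclosure, ht₀, -⟩, hmin⟩ := hK.exists_isMinOn ⟨_, hmem⟩
    (f := fun q => (c + 1) * q.1 + ‖q.2 - a₁‖) (by fun_prop)
  have hzero : ∀ q ∈ Icc 0 T ×ˢ univ,
      (c + 1) * q.1 + ‖q.2 - a₁‖ < (c + 1) * t₀ + ‖a₀ - a₁‖ → W q = 0 := by
    intro q hq hlt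
    by_contra hqW
    have hle : (c + 1) * t₀ + ‖a₀ - a₁‖ ≤ (c + 1) * t₁ + ‖a₁ - a₁‖ := hmin hmem
    rw [sub_self, norm_zero] at hle
    have hqK : q ∈ K := ⟨subset_closure ⟨hq, hqW⟩, hq.1, mem_closedBall_iff_norm.2 <| by
      nlinarith [hq.1.1, ht₁.2]⟩
    exact (hmin hqK).not_gt hlt
  refine mem_closure_iff_frequently.1 hclosure ?_
  have hvanish := eventually_eq_zero_of_finite_speed hc hW h₀ (hspeed t₀ ht₀ a₀ fun t ht => ?_)
    hzero
  · filter_upwards [eventually_nhdsWithin_iff.1 hvanish] with q hq hqS using hqS.2 (hq hqS.1)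
  · have hcont : Tendsto (fun a => (c + 1) * t + ‖a - a₁‖) (𝓝 a₀)
        (𝓝 ((c + 1) * t + ‖a₀ - a₁‖)) := Continuous.tendsto (by fun_prop) a₀
    have hlt : (c + 1) * t + ‖a₀ - a₁‖ < (c + 1) * t₀ + ‖a₀ - a₁‖ := by gcongr; exact ht.2
    filter_upwards [hcont.eventually_lt_const hlt] with a ha
    exact hzero (t, a) ⟨⟨ht.1, ht.2.le.trans ht₀.2⟩, mem_univ _⟩ ha

end FiniteSpeed

section Gradients

variable {E F G : Type*} [NormedAddCommGroup E] [NormedSpace ℝ E] [NormedAddCommGroup F]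
  [InnerProductSpace ℝ F] [CompleteSpace F] [NormedAddCommGroup G] [NormedSpace ℝ G]

theorem gradient_slice_fst {f : F × G → ℝ} {z : F × G} (hf : DifferentiableAt ℝ f z) :
    gradient (fun y => f (y, z.2)) z.1 =
      (InnerProductSpace.toDual ℝ F).symm ((fderiv ℝ f z).comp (.inl ℝ F G)) := by
  exact congrArg _ (HasFDerivAt.comp (f := fun y => (y, z.2)) z.1 hf.hasFDerivAt
    (hasFDerivAt_prodMk_left z.1 z.2)).fderiv

theorem gradient_slice_snd_fst {f : E × F × G → ℝ} {z : E × F × G}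
    (hf : DifferentiableAt ℝ f z) :
    gradient (fun v => f (z.1, v, z.2.2)) z.2.1 = (InnerProductSpace.toDual ℝ F).symm
      ((fderiv ℝ f z).comp ((ContinuousLinearMap.inr ℝ E (F × G)).comp (.inl ℝ F G))) := by
  exact congrArg _ (HasFDerivAt.comp (f := fun v => (z.1, v, z.2.2)) z.2.1 hf.hasFDerivAt
    (HasFDerivAt.comp (f := fun v => (v, z.2.2)) z.2.1 (hasFDerivAt_prodMk_right z.1 z.2)
      (hasFDerivAt_prodMk_left z.2.1 z.2.2))).fderiv

end Gradients

section Diffeomorphisms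

variable {E F : Type*} [NormedAddCommGroup E] [NormedSpace ℝ E] [NormedAddCommGroup F]
  [NormedSpace ℝ F] {f : E → F}

theorem IsC1Diffeo.bijective (hf : IsC1Diffeo f) : Function.Bijective f := by
  obtain ⟨Φ, hΦ⟩ := hf
  exact funext hΦ ▸ Φ.bijective

theorem IsC1Diffeo.contDiff (hf : IsC1Diffeo f) : ContDiff ℝ 1 f := by
  obtain ⟨Φ, hΦ⟩ := hf
  exact funext hΦ ▸ Φ.contMDiff.contDiff

theorem IsC1Diffeo.contDiff_invFun (hf : IsC1Diffeo f) :
    ContDiff ℝ 1 (Function.invFun f) := by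
  obtain ⟨Φ, hΦ⟩ := hf
  have hinv : Function.invFun f = Φ.symm := by
    funext z
    obtain ⟨w, rfl⟩ : ∃ w, Φ w = z := Φ.surjective z
    rw [← funext hΦ, Φ.symm_apply_apply]
    exact Function.leftInverse_invFun Φ.injective w
  exact hinv ▸ Φ.symm.contMDiff.contDiff

theorem IsC1Diffeo.exists_equiv_eq_fderiv (hf : IsC1Diffeo f) (z : E) :
    ∃ A : E ≃L[ℝ] F, (A : E →L[ℝ] F) = fderiv ℝ f z := by
  obtain ⟨Φ, hΦ⟩ := hf
  refine ⟨Φ.mfderivToContinuousLinearEquiv one_ne_zero z, ?_⟩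
  rw [← funext hΦ, ← mfderiv_eq_fderiv]
  exact Φ.mfderivToContinuousLinearEquiv_coe one_ne_zero

end Diffeomorphisms

section Legendre

variable {L : ExtPhase N → ℝ}

/-- The velocity `v` with `L_v(x, v, t) = p`, as a function of `z = (x, p, t)`. -/
def velocity (L : ExtPhase N → ℝ) (z : ExtPhase N) : Conf N :=
  (Function.invFun (legendreMap L) z).2.1

/-- The force `L_x(x, v, t)` as a function of `z = (x, p, t)`, where `p = L_v(x, v, t)`. -/
def force (L : ExtPhase N → ℝ) (z : ExtPhase N) : Conf N :=
  gradient (fun y => L (y, velocity L z, z.2.2)) z.1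

theorem invFun_legendreMap (hleg : IsC1Diffeo (legendreMap L)) (z : ExtPhase N) :
    Function.invFun (legendreMap L) z = (z.1, velocity L z, z.2.2) := by
  have h := Function.rightInverse_invFun hleg.bijective.surjective z
  exact Prod.ext (congrArg Prod.fst h :) (Prod.ext rfl (congrArg (fun q => q.2.2) h :))

theorem contDiff_velocity (hleg : IsC1Diffeo (legendreMap L)) : ContDiff ℝ 1 (velocity L) :=
  hleg.contDiff_invFun.snd.fst

theorem legendreMap_velocity (hleg : IsC1Diffeo (legendreMap L)) (z : ExtPhase N) :
    legendreMap L (z.1, velocity L z, z.2.2) = z := by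
  rw [← invFun_legendreMap hleg]
  exact Function.rightInverse_invFun hleg.bijective.surjective z

theorem force_eq_toDual_symm (hL : Differentiable ℝ L) (z : ExtPhase N) :
    force L z = (InnerProductSpace.toDual ℝ (Conf N)).symm
      ((fderiv ℝ L (z.1, velocity L z, z.2.2)).comp (.inl ℝ (Conf N) (Conf N × ℝ))) :=
  gradient_slice_fst (hL (z.1, velocity L z, z.2.2))

theorem contDiff_force (hL : ContDiff ℝ 2 L) (hleg : IsC1Diffeo (legendreMap L)) :
    ContDiff ℝ 1 (force L) := by
  have hdL : ContDiff ℝ 1 (fderiv ℝ L) := hL.fderiv_right le_rfl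
  have hvel := contDiff_velocity hleg
  rw [funext (force_eq_toDual_symm (hL.differentiable two_ne_zero))]
  exact (InnerProductSpace.toDual ℝ (Conf N)).symm.toContinuousLinearEquiv.contDiff.comp
    ((hdL.comp (by fun_prop)).clm_comp contDiff_const)

theorem fderiv_lagrangian (hL : Differentiable ℝ L) (hleg : IsC1Diffeo (legendreMap L))
    (z : ExtPhase N) (a b : Conf N) :
    fderiv ℝ L (z.1, velocity L z, z.2.2) (a, b, 0) =
      inner ℝ (force L z) a + inner ℝ z.2.1 b := by
  have hposition : inner ℝ (force L z) a = fderiv ℝ L (z.1, velocity L z, z.2.2) (a, 0, 0) := by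
    rw [force_eq_toDual_symm hL, InnerProductSpace.toDual_symm_apply]
    rfl
  have hvelocity : inner ℝ z.2.1 b = fderiv ℝ L (z.1, velocity L z, z.2.2) (0, b, 0) := by
    conv_lhs => rw [← legendreMap_velocity hleg z, legendreMap, gradient_slice_snd_fst (hL _),
      InnerProductSpace.toDual_symm_apply]
    rfl
  rw [hposition, hvelocity, ← map_add]
  simp

theorem hamiltonian_eq (hleg : IsC1Diffeo (legendreMap L)) (z : ExtPhase N) :
    hamiltonian L z = inner ℝ z.2.1 (velocity L z) - L (z.1, velocity L z, z.2.2) := by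
  rw [hamiltonian, invFun_legendreMap hleg]

theorem contDiff_hamiltonian (hL : ContDiff ℝ 1 L) (hleg : IsC1Diffeo (legendreMap L)) :
    ContDiff ℝ 1 (hamiltonian L) := by
  have hvel := contDiff_velocity hleg
  rw [funext (hamiltonian_eq hleg)]
  exact (ContDiff.inner ℝ (by fun_prop) hvel).sub (hL.comp (by fun_prop))

-- The derivative of the velocity drops out because `p = L_v` (envelope theorem).
theorem fderiv_hamiltonian (hL : Differentiable ℝ L) (hleg : IsC1Diffeo (legendreMap L))
    (z : ExtPhase N) (a b : Conf N) :
    fderiv ℝ (hamiltonian L) z (a, b, 0) =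
      inner ℝ (velocity L z) b - inner ℝ (force L z) a := by
  have hvel : HasFDerivAt (velocity L) (fderiv ℝ (velocity L) z) z :=
    ((contDiff_velocity hleg).differentiable one_ne_zero z).hasFDerivAt
  have hsnd : HasFDerivAt (fun z : ExtPhase N => z.2) (.snd ℝ _ _) z := hasFDerivAt_snd
  have hlift := hasFDerivAt_fst.prodMk (hvel.prodMk hsnd.snd)
  have hH := (hsnd.fst.inner ℝ hvel).sub ((hL _).hasFDerivAt.comp z hlift)
  rw [(hH.congr_of_eventuallyEq (.of_forall (hamiltonian_eq hleg))).fderiv]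
  have hdL := fderiv_lagrangian hL hleg z a (fderiv ℝ (velocity L) z (a, b, 0))
  simp only [sub_apply, ContinuousLinearMap.comp_apply, ContinuousLinearMap.prod_apply,
    ContinuousLinearMap.coe_fst', ContinuousLinearMap.coe_snd', fderivInnerCLM_apply, hdL,
    real_inner_comm b]
  ring

theorem gradient_hamiltonian_momentum (hL : ContDiff ℝ 1 L) (hleg : IsC1Diffeo (legendreMap L))
    (y q : Conf N) (t : ℝ) :
    gradient (fun q => hamiltonian L (y, q, t)) q = velocity L (y, q, t) := by
  have hH := (contDiff_hamiltonian hL hleg).differentiable one_ne_zero (y, q, t)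
  refine ext_inner_right ℝ fun b => ?_
  rw [gradient_slice_snd_fst (z := (y, q, t)) hH, InnerProductSpace.toDual_symm_apply]
  simpa using fderiv_hamiltonian (hL.differentiable one_ne_zero) hleg (y, q, t) 0 b

theorem gradient_hamiltonian_position (hL : ContDiff ℝ 1 L) (hleg : IsC1Diffeo (legendreMap L))
    (y q : Conf N) (t : ℝ) :
    gradient (fun y => hamiltonian L (y, q, t)) y = -force L (y, q, t) := by
  have hH := (contDiff_hamiltonian hL hleg).differentiable one_ne_zero (y, q, t)
  refine ext_inner_right ℝ fun a => ?_
  rw [gradient_slice_fst (z := (y, q, t)) hH, InnerProductSpace.toDual_symm_apply,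
    inner_neg_left]
  exact (fderiv_hamiltonian (hL.differentiable one_ne_zero) hleg (y, q, t) a 0).trans (by simp)

end Legendre

section Rays

variable {L : ExtPhase N → ℝ} {S₀ : Conf N → ℝ} {T : ℝ} {x p : ℝ → Conf N → Conf N}

/-- The Hamiltonian vector field `(H_p, -H_x)` on phase space at time `t`, written in terms of the
Lagrangian. -/
def phaseField (L : ExtPhase N → ℝ) (t : ℝ) (z : Conf N × Conf N) : Conf N × Conf N :=
  (velocity L (z.1, z.2, t), force L (z.1, z.2, t))

/-- The setting of the method of characteristics: `x`, `p` is the Hamilton flow on `[0, T]` of a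
Lagrangian `L` with invertible Legendre map, it starts on the graph of `∇S₀`, and its rays cover
the configuration space diffeomorphically at every time. -/
structure IsRayFamily (L : ExtPhase N → ℝ) (S₀ : Conf N → ℝ) (T : ℝ)
    (x p : ℝ → Conf N → Conf N) : Prop where
  lagrangian : ContDiff ℝ 2 L
  legendre : IsC1Diffeo (legendreMap L)
  initial : ContDiff ℝ 1 S₀
  pos : 0 < T
  flow : IsHamiltonFlow (hamiltonian L) S₀ T x p
  diffeo : ∀ t ∈ Icc 0 T, IsC1Diffeo (x t)

theorem contDiff_phaseField (hL : ContDiff ℝ 2 L) (hleg : IsC1Diffeo (legendreMap L)) :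
    ContDiff ℝ 1 fun q : ℝ × Conf N × Conf N => phaseField L q.1 q.2 :=
  ((contDiff_velocity hleg).comp (by fun_prop)).prodMk
    ((contDiff_force hL hleg).comp (by fun_prop))

namespace IsRayFamily

theorem zero_mem (h : IsRayFamily L S₀ T x p) : (0 : ℝ) ∈ Icc 0 T := left_mem_Icc.2 h.pos.le

theorem hasDerivWithinAt_position (h : IsRayFamily L S₀ T x p) (a : Conf N) {t : ℝ}
    (ht : t ∈ Icc 0 T) :
    HasDerivWithinAt (fun s => x s a) (velocity L (x t a, p t a, t)) (Icc 0 T) t := by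
  rw [← gradient_hamiltonian_momentum (h.lagrangian.of_le one_le_two) h.legendre]
  exact h.flow.position a t ht

theorem hasDerivWithinAt_momentum (h : IsRayFamily L S₀ T x p) (a : Conf N) {t : ℝ}
    (ht : t ∈ Icc 0 T) :
    HasDerivWithinAt (fun s => p s a) (force L (x t a, p t a, t)) (Icc 0 T) t := by
  rw [← neg_neg (force L _),
    ← gradient_hamiltonian_position (h.lagrangian.of_le one_le_two) h.legendre]
  exact h.flow.momentum a t ht

theorem hasDerivWithinAt_phase (h : IsRayFamily L S₀ T x p) (a : Conf N) {t : ℝ}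
    (ht : t ∈ Icc 0 T) :
    HasDerivWithinAt (fun s => (x s a, p s a)) (phaseField L t (x t a, p t a)) (Icc 0 T) t :=
  (h.hasDerivWithinAt_position a ht).prodMk (h.hasDerivWithinAt_momentum a ht)

theorem continuous_phase_zero (h : IsRayFamily L S₀ T x p) :
    Continuous fun a => (x 0 a, p 0 a) := by
  simp only [h.flow.position_zero, h.flow.momentum_zero, gradient]
  exact continuous_id.prodMk ((InnerProductSpace.toDual ℝ (Conf N)).symm.continuous.comp
    (h.initial.continuous_fderiv one_ne_zero))

theorem continuousOn_phase (h : IsRayFamily L S₀ T x p) :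
    ContinuousOn (fun q : ℝ × Conf N => (x q.1 q.2, p q.1 q.2)) (Icc 0 T ×ˢ univ) :=
  continuousOn_uncurry_of_trajectories (z := fun t a => (x t a, p t a))
    (contDiff_phaseField h.lagrangian h.legendre).locallyLipschitz
    (fun a _ ht => h.hasDerivWithinAt_phase a ht) h.continuous_phase_zero

-- `∇S₀` need not be Lipschitz: the bound holds because the rays stay `C¹` at a small positive
-- time, where the initial velocities have become visible in the positions.
theorem isBigO_phase_zero (h : IsRayFamily L S₀ T x p) (a : Conf N) :
    (fun q : Conf N × Conf N => (x 0 q.1, p 0 q.1) - (x 0 q.2, p 0 q.2))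
      =O[𝓝 (a, a)] fun q => q.1 - q.2 := by
  set V : Conf N → Conf N := fun b => velocity L (x 0 b, p 0 b, 0)
  have hposition : ∀ b, x 0 b = b := h.flow.position_zero
  have hexp := isLittleO_sub_of_trajectories (z := fun t a => (x t a, p t a)) h.pos.le
    (contDiff_phaseField h.lagrangian h.legendre)
    (fun a _ ht => h.hasDerivWithinAt_phase a ht) h.continuous_phase_zero a
  refine isBigO_of_isLittleO_smul h.pos (X := fun t q => x t q.1 - x t q.2)
    (v := fun q => V q.1 - V q.2)
    (fun t ht => isBigO_sub_of_locallyLipschitz (h.diffeo t ht).contDiff.locallyLipschitz a)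
    (((ContinuousLinearMap.fst ℝ (Conf N) (Conf N)).isBigO_comp _ _).trans_isLittleO hexp
      |>.congr_left fun q => ?_) ?_
  · simp [phaseField, V, hposition]
  · have hVcont : Continuous V := (contDiff_velocity h.legendre).continuous.comp
      (h.continuous_phase_zero.fst.prodMk (h.continuous_phase_zero.snd.prodMk continuous_const))
    have hphase : ∀ b, (x 0 b, p 0 b) =
        ((legendreMap L (b, V b, 0)).1, (legendreMap L (b, V b, 0)).2.1) := fun b => by
      have := legendreMap_velocity h.legendre (x 0 b, p 0 b, 0)
      simp only [hposition] at this
      simp only [V, hposition, this]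
    have hlip : LocallyLipschitz fun u : ExtPhase N =>
        ((legendreMap L u).1, (legendreMap L u).2.1) :=
      (h.legendre.contDiff.fst.prodMk h.legendre.contDiff.snd.fst).locallyLipschitz
    simp only [hphase]
    refine ((isBigO_sub_of_locallyLipschitz hlip (a, V a, 0)).comp_tendsto
      (k := fun q : Conf N × Conf N => ((q.1, V q.1, 0), (q.2, V q.2, 0)))
      (Continuous.tendsto (by fun_prop) (a, a))).trans (isBigO_of_le _ fun q => ?_)
    simp [Prod.norm_def]

theorem isBigO_phase (h : IsRayFamily L S₀ T x p) (a : Conf N) (t : ℝ) :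
    (fun q : ℝ × Conf N × Conf N => (x q.1 q.2.1, p q.1 q.2.1) - (x q.1 q.2.2, p q.1 q.2.2))
      =O[𝓝[Icc 0 T] t ×ˢ 𝓝 (a, a)] fun q => q.2.1 - q.2.2 :=
  (isBigO_sub_of_trajectories (z := fun t a => (x t a, p t a))
    (contDiff_phaseField h.lagrangian h.legendre).locallyLipschitz
    (fun a _ ht => h.hasDerivWithinAt_phase a ht) h.continuous_phase_zero a t).trans
    ((h.isBigO_phase_zero a).comp_tendsto tendsto_snd)

theorem isBigO_velocity (h : IsRayFamily L S₀ T x p) (a : Conf N) {t : ℝ} (ht : t ∈ Icc 0 T) :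
    (fun q : ℝ × Conf N × Conf N => velocity L (x q.1 q.2.1, p q.1 q.2.1, q.1) -
        velocity L (x q.1 q.2.2, p q.1 q.2.2, q.1))
      =O[𝓝[Icc 0 T] t ×ˢ 𝓝 (a, a)] fun q => q.2.1 - q.2.2 :=
  (isBigO_field_sub_of_trajectories (z := fun t a => (x t a, p t a))
    (contDiff_phaseField h.lagrangian h.legendre).locallyLipschitz
    (fun a _ ht => h.hasDerivWithinAt_phase a ht) h.continuous_phase_zero a ht).prod_left_fst.trans
    ((h.isBigO_phase_zero a).comp_tendsto tendsto_snd)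

theorem isLittleO_position (h : IsRayFamily L S₀ T x p) (a : Conf N) {t : ℝ} (ht : t ∈ Icc 0 T) :
    (fun q : ℝ × Conf N × Conf N =>
        x q.1 q.2.1 - x q.1 q.2.2 - fderiv ℝ (x t) a (q.2.1 - q.2.2))
      =o[𝓝[Icc 0 T] t ×ˢ 𝓝 (a, a)] fun q => q.2.1 - q.2.2 := by
  have htime := isBigO_increment_of_hasDerivWithinAt (convex_Icc 0 T) ht
    (g := fun s (q : Conf N × Conf N) => x s q.1 - x s q.2)
    (fun q s hs => (h.hasDerivWithinAt_position q.1 hs).sub (h.hasDerivWithinAt_position q.2 hs))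
    (h := fun q => q.1 - q.2) (h.isBigO_velocity a ht)
  have hsmall : (fun q : ℝ × Conf N × Conf N => q.1 - t) =o[𝓝[Icc 0 T] t ×ˢ 𝓝 (a, a)]
      fun _ => (1 : ℝ) := by
    rw [isLittleO_one_iff]
    exact (Continuous.tendsto' (f := fun s : ℝ => s - t) (by fun_prop) t 0 (by simp)).comp
      (tendsto_fst.mono_right nhdsWithin_le_nhds)
  have hspace := ((h.diffeo t ht).contDiff.contDiffAt.hasStrictFDerivAt one_ne_zero
    (x := a)).isLittleO.comp_tendsto (tendsto_snd (f := 𝓝[Icc 0 T] t) (g := 𝓝 (a, a)))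
  refine ((htime.trans_isLittleO ((hsmall.smul_isBigO (isBigO_refl _ _)).congr_right
    fun q => one_smul ℝ (q.2.1 - q.2.2))).add hspace).congr_left fun q => ?_
  simp only [Function.comp_apply]
  abel

theorem tendsto_fderiv_position (h : IsRayFamily L S₀ T x p) (a : Conf N) {t : ℝ}
    (ht : t ∈ Icc 0 T) :
    Tendsto (fun q : ℝ × Conf N => fderiv ℝ (x q.1) q.2) (𝓝[Icc 0 T ×ˢ univ] (t, a))
      (𝓝 (fderiv ℝ (x t) a)) := by
  rw [nhdsWithin_prod_eq, nhdsWithin_univ]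
  refine tendsto_fderiv_of_isLittleO (X' := fun s => fderiv ℝ (x s)) (h.isLittleO_position a ht) ?_
  filter_upwards [self_mem_nhdsWithin] with s hs b
  exact ((h.diffeo s hs).contDiff.differentiable one_ne_zero b).hasFDerivAt

theorem position_invFun (h : IsRayFamily L S₀ T x p) {t : ℝ} (ht : t ∈ Icc 0 T) (y : Conf N) :
    x t (Function.invFun (x t) y) = y :=
  Function.rightInverse_invFun (h.diffeo t ht).bijective.surjective y

theorem invFun_position (h : IsRayFamily L S₀ T x p) {t : ℝ} (ht : t ∈ Icc 0 T) (a : Conf N) :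
    Function.invFun (x t) (x t a) = a :=
  Function.leftInverse_invFun (h.diffeo t ht).bijective.injective a

theorem continuousOn_invFun (h : IsRayFamily L S₀ T x p) :
    ContinuousOn (fun q : ℝ × Conf N => Function.invFun (x q.1) q.2) (Icc 0 T ×ˢ univ) := by
  rintro ⟨t, y⟩ ⟨ht, -⟩
  obtain ⟨A, hA⟩ := (h.diffeo t ht).exists_equiv_eq_fderiv (Function.invFun (x t) y)
  have hcont := (h.hasDerivWithinAt_position (Function.invFun (x t) y) ht).continuousWithinAt
  rw [ContinuousWithinAt, h.position_invFun ht] at hcont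
  rw [ContinuousWithinAt, nhdsWithin_prod_eq, nhdsWithin_univ]
  refine tendsto_inverse_of_isLittleO (Y := fun s => Function.invFun (x s)) (A := A) ?_ ?_ hcont
  · simpa only [← hA, ContinuousLinearEquiv.coe_coe] using
      h.isLittleO_position (Function.invFun (x t) y) ht
  · filter_upwards [self_mem_nhdsWithin] with s hs using h.invFun_position hs

end IsRayFamily

end Rays

section FirstVariation

theorem isLittleO_sub_sub_fderiv_of_contDiff {E F : Type*} [NormedAddCommGroup E]
    [NormedSpace ℝ E] [NormedAddCommGroup F] [NormedSpace ℝ F] {f : E → F} (hf : ContDiff ℝ 1 f)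
    (x : E) :
    (fun q : E × E => f q.1 - f q.2 - fderiv ℝ f q.2 (q.1 - q.2))
      =o[𝓝 (x, x)] fun q => q.1 - q.2 := by
  have hstrict := (hf.contDiffAt.hasStrictFDerivAt one_ne_zero (x := x)).isLittleO
  have hderiv : (fun q : E × E => fderiv ℝ f x - fderiv ℝ f q.2) =o[𝓝 (x, x)]
      fun _ => (1 : ℝ) := by
    have := hf.continuous_fderiv one_ne_zero
    rw [isLittleO_one_iff]
    exact Continuous.tendsto' (by fun_prop) _ _ (sub_self _)
  have herror : (fun q : E × E => (fderiv ℝ f x - fderiv ℝ f q.2) (q.1 - q.2)) =o[𝓝 (x, x)]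
      fun q => q.1 - q.2 := by
    refine IsBigO.trans_isLittleO (isBigO_of_le _ fun q => ?_)
      ((hderiv.norm_left.smul_isBigO (isBigO_refl (fun q : E × E => q.1 - q.2) _)).congr_right
        fun q => one_smul ℝ (q.1 - q.2))
    simpa only [norm_smul, norm_norm] using
      (fderiv ℝ f x - fderiv ℝ f q.2).le_opNorm (q.1 - q.2)
  refine (hstrict.add herror).congr_left fun q => ?_
  rw [sub_apply]
  abel

variable {L : ExtPhase N → ℝ} {S₀ : Conf N → ℝ} {T : ℝ} {x p : ℝ → Conf N → Conf N}

/-- The point `(x, ẋ, t)` on the ray from `a` at time `t`, where `L` is evaluated in the action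
integral; the velocity is expressed through the momentum. -/
def rayState (L : ExtPhase N → ℝ) (x p : ℝ → Conf N → Conf N) (t : ℝ) (a : Conf N) : ExtPhase N :=
  (x t a, velocity L (x t a, p t a, t), t)

theorem rayAction_zero (L : ExtPhase N → ℝ) (S₀ : Conf N → ℝ) (T : ℝ)
    (x : ℝ → Conf N → Conf N) (a : Conf N) : rayAction L S₀ T x 0 a = S₀ a := by
  simp only [rayAction, intervalIntegral.integral_same, add_zero]

namespace IsRayFamily

theorem continuousOn_rayState (h : IsRayFamily L S₀ T x p) :
    ContinuousOn (fun q : ℝ × Conf N => rayState L x p q.1 q.2) (Icc 0 T ×ˢ univ) :=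
  h.continuousOn_phase.fst.prodMk (((contDiff_velocity h.legendre).continuous.comp_continuousOn
    (h.continuousOn_phase.fst.prodMk (h.continuousOn_phase.snd.prodMk continuousOn_fst))).prodMk
      continuousOn_fst)

theorem isBigO_rayState (h : IsRayFamily L S₀ T x p) (a : Conf N) {t : ℝ} (ht : t ∈ Icc 0 T) :
    (fun q : ℝ × Conf N => rayState L x p q.1 q.2 - rayState L x p q.1 a)
      =O[𝓝[Icc 0 T] t ×ˢ 𝓝 a] fun q => q.2 - a := by
  have hpair : Tendsto (fun q : ℝ × Conf N => (q.1, q.2, a)) (𝓝[Icc 0 T] t ×ˢ 𝓝 a)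
      (𝓝[Icc 0 T] t ×ˢ 𝓝 (a, a)) :=
    tendsto_id.prodMap (Continuous.tendsto (f := fun b : Conf N => (b, a)) (by fun_prop) a)
  refine (((h.isBigO_phase a t).prod_left_fst.comp_tendsto hpair).prod_left
    (((h.isBigO_velocity a ht).comp_tendsto hpair).prod_left (isBigO_zero _ _))).congr_left
      fun q => ?_
  simp [rayState]

theorem hasDerivWithinAt_rayAction (h : IsRayFamily L S₀ T x p) (a : Conf N) {t : ℝ}
    (ht : t ∈ Icc 0 T) :
    HasDerivWithinAt (fun s => rayAction L S₀ T x s a) (L (rayState L x p t a)) (Icc 0 T) t := by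
  have hcont : ContinuousOn (fun s => L (rayState L x p s a)) (Icc 0 T) :=
    h.lagrangian.continuous.comp_continuousOn (h.continuousOn_rayState.comp
      (f := fun s : ℝ => (s, a)) (by fun_prop) fun s hs => ⟨hs, mem_univ _⟩)
  set g : ℝ → ℝ := IccExtend h.pos.le ((Icc 0 T).domRestrict fun s => L (rayState L x p s a))
  have hg : Continuous g := (continuousOn_iff_continuous_domRestrict.1 hcont).Icc_extend'
  have hg_eq : ∀ s ∈ Icc 0 T, g s = L (rayState L x p s a) := fun s hs => IccExtend_of_mem _ _ hs
  have hderiv : HasDerivAt (fun s => S₀ a + ∫ r in (0 : ℝ)..s, g r) (g t) t :=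
    (hg.integral_hasStrictDerivAt 0 t).hasDerivAt.const_add (S₀ a)
  have heq : ∀ s ∈ Icc 0 T, rayAction L S₀ T x s a = S₀ a + ∫ r in (0 : ℝ)..s, g r := by
    intro s hs
    refine congrArg (S₀ a + ·) (intervalIntegral.integral_congr fun r hr => ?_)
    rw [uIcc_of_le hs.1] at hr
    have hr' : r ∈ Icc 0 T := ⟨hr.1, hr.2.trans hs.2⟩
    simp only [hg_eq r hr', rayState,
      (h.hasDerivWithinAt_position a hr').derivWithin (uniqueDiffOn_Icc h.pos r hr')]
  exact hg_eq t ht ▸ hderiv.hasDerivWithinAt.congr heq (heq t ht)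

-- The Euler–Lagrange equation turns the first variation of `L` along a ray into the total time
-- derivative of `⟪p, δx⟫`.
theorem hasDerivWithinAt_rayAction_sub (h : IsRayFamily L S₀ T x p) (a b : Conf N) {t : ℝ}
    (ht : t ∈ Icc 0 T) :
    HasDerivWithinAt
      (fun s => rayAction L S₀ T x s b - rayAction L S₀ T x s a - inner ℝ (p s a) (x s b - x s a))
      (L (rayState L x p t b) - L (rayState L x p t a) - fderiv ℝ L (rayState L x p t a)
        (rayState L x p t b - rayState L x p t a)) (Icc 0 T) t := by
  have hvariation (u v : Conf N) : fderiv ℝ L (rayState L x p t a) (u, v, 0) =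
      inner ℝ (p t a) v + inner ℝ (force L (x t a, p t a, t)) u :=
    (fderiv_lagrangian (h.lagrangian.differentiable two_ne_zero) h.legendre
      (x t a, p t a, t) u v).trans (add_comm _ _)
  have hsub : rayState L x p t b - rayState L x p t a = (x t b - x t a,
      velocity L (x t b, p t b, t) - velocity L (x t a, p t a, t), 0) := by simp [rayState]
  rw [hsub, hvariation]
  exact ((h.hasDerivWithinAt_rayAction b ht).fun_sub (h.hasDerivWithinAt_rayAction a ht)).fun_sub
    ((h.hasDerivWithinAt_momentum a ht).inner ℝ
      ((h.hasDerivWithinAt_position b ht).fun_sub (h.hasDerivWithinAt_position a ht)))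

theorem isLittleO_rayAction_sub (h : IsRayFamily L S₀ T x p) (a : Conf N) {t : ℝ}
    (ht : t ∈ Icc 0 T) :
    (fun b => rayAction L S₀ T x t b - rayAction L S₀ T x t a - inner ℝ (p t a) (x t b - x t a))
      =o[𝓝 a] fun b => b - a := by
  have hremainder : ∀ s ∈ Icc 0 T, (fun q : ℝ × Conf N =>
      L (rayState L x p q.1 q.2) - L (rayState L x p q.1 a) - fderiv ℝ L (rayState L x p q.1 a)
        (rayState L x p q.1 q.2 - rayState L x p q.1 a))
      =o[𝓝[Icc 0 T] s ×ˢ 𝓝 a] fun q => q.2 - a := fun s hs => by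
    have hlim : Tendsto (fun q : ℝ × Conf N => rayState L x p q.1 q.2) (𝓝[Icc 0 T] s ×ˢ 𝓝 a)
        (𝓝 (rayState L x p s a)) := by
      simpa only [ContinuousWithinAt, nhdsWithin_prod_eq, nhdsWithin_univ] using
        h.continuousOn_rayState (s, a) ⟨hs, mem_univ _⟩
    have hlim_a : Tendsto (fun q : ℝ × Conf N => rayState L x p q.1 a) (𝓝[Icc 0 T] s ×ˢ 𝓝 a)
        (𝓝 (rayState L x p s a)) :=
      hlim.comp (tendsto_fst.prodMk tendsto_const_nhds)
    exact ((isLittleO_sub_sub_fderiv_of_contDiff (h.lagrangian.of_le one_le_two) _).comp_tendsto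
      (hlim.prodMk_nhds hlim_a)).trans_isBigO (h.isBigO_rayState a hs)
  have hincrement := isLittleO_sub_of_hasDerivWithinAt (h := fun b => b - a) (convex_Icc 0 T)
    isCompact_Icc (fun b s hs => h.hasDerivWithinAt_rayAction_sub a b hs) hremainder h.zero_mem ht
  have hinitial : (fun b => S₀ b - S₀ a - inner ℝ (gradient S₀ a) (b - a)) =o[𝓝 a]
      fun b => b - a :=
    ((h.initial.differentiable one_ne_zero a).hasGradientAt.hasFDerivAt).isLittleO
  refine (hincrement.add hinitial).congr_left fun b => ?_
  simp only [rayAction_zero, h.flow.position_zero, h.flow.momentum_zero]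
  ring

theorem hasFDerivAt_rayAction (h : IsRayFamily L S₀ T x p) (a : Conf N) {t : ℝ}
    (ht : t ∈ Icc 0 T) :
    HasFDerivAt (rayAction L S₀ T x t) ((innerSL ℝ (p t a)).comp (fderiv ℝ (x t) a)) a := by
  have hx := ((h.diffeo t ht).contDiff.differentiable one_ne_zero a).hasFDerivAt.isLittleO
  refine .of_isLittleO (((h.isLittleO_rayAction_sub a ht).add
    (((innerSL ℝ (p t a)).isBigO_comp _ _).trans_isLittleO hx)).congr_left fun b => ?_)
  simp only [ContinuousLinearMap.comp_apply, innerSL_apply_apply, inner_sub_right]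
  ring

end IsRayFamily

end FirstVariation

section Action

variable {E F : Type*} [NormedAddCommGroup E] [InnerProductSpace ℝ E] [NormedAddCommGroup F]
  [NormedSpace ℝ F]

/-- The differential `(δt, δy) ↦ τ δt + ⟪g, δy⟫` of a function of time and space with time
derivative `τ` and spatial gradient `g`. -/
def spacetimeDifferential (τ : ℝ) (g : E) : ℝ × E →L[ℝ] ℝ :=
  (ContinuousLinearMap.toSpanSingleton ℝ τ).coprod (innerSL ℝ g)

theorem spacetimeDifferential_apply (τ : ℝ) (g : E) (q : ℝ × E) :
    spacetimeDifferential τ g q = q.1 * τ + inner ℝ g q.2 := by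
  simp [spacetimeDifferential]

theorem continuous_spacetimeDifferential :
    Continuous fun q : ℝ × E => spacetimeDifferential q.1 q.2 :=
  (ContinuousLinearMap.coprodEquivL (𝕜 := ℝ) (E := ℝ) (F := E) (G := ℝ) ℝ).continuous.comp
    (((ContinuousLinearMap.toSpanSingletonCLE (𝕜 := ℝ) (E := ℝ)).continuous.comp
      continuous_fst).prodMk ((innerSL ℝ).continuous.comp continuous_snd))

theorem hasGradientAt_of_hasFDerivWithinAt_uncurry [CompleteSpace E] {S : ℝ → E → ℝ} {s : Set ℝ}
    {τ t : ℝ} {g y : E} (hS : HasFDerivWithinAt (fun q : ℝ × E => S q.1 q.2)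
      (spacetimeDifferential τ g) (s ×ˢ univ) (t, y)) (ht : t ∈ s) :
    HasGradientAt (S t) g y := by
  have hslice := hS.comp y ((hasFDerivAt_prodMk_right t y).hasFDerivWithinAt (s := univ))
    fun z _ => ⟨ht, mem_univ z⟩
  refine (hasFDerivWithinAt_univ.1 hslice).congr_fderiv (ContinuousLinearMap.ext fun η => ?_)
  simp [spacetimeDifferential_apply]

theorem derivWithin_of_hasFDerivWithinAt_uncurry {S : ℝ → E → F} {s : Set ℝ}
    {D : ℝ × E →L[ℝ] F} {t : ℝ} {y : E}
    (hS : HasFDerivWithinAt (fun q : ℝ × E => S q.1 q.2) D (s ×ˢ univ) (t, y))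
    (hs : UniqueDiffWithinAt ℝ s t) : derivWithin (fun r => S r y) s t = D (1, 0) := by
  have hline : HasDerivWithinAt (fun r : ℝ => (r, y)) (1, 0) s t :=
    (hasDerivWithinAt_id t s).prodMk (hasDerivWithinAt_const t s y)
  exact (hS.comp_hasDerivWithinAt t hline fun _ hr => mk_mem_prod hr (mem_univ y)).derivWithin hs

variable {L : ExtPhase N → ℝ} {S₀ : Conf N → ℝ} {T : ℝ} {x p : ℝ → Conf N → Conf N}

/-- The differential at `(t, a)` of the ray map `(t, a) ↦ (t, x(t, a))`. -/
def rayDifferential (L : ExtPhase N → ℝ) (x p : ℝ → Conf N → Conf N) (t : ℝ) (a : Conf N) :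
    ℝ × Conf N →L[ℝ] ℝ × Conf N :=
  (ContinuousLinearMap.fst ℝ ℝ (Conf N)).prod
    ((ContinuousLinearMap.toSpanSingleton ℝ (velocity L (x t a, p t a, t))).coprod
      (fderiv ℝ (x t) a))

namespace IsRayFamily

theorem hasFDerivWithinAt_rayMap (h : IsRayFamily L S₀ T x p) {q : ℝ × Conf N}
    (hq : q ∈ Icc 0 T ×ˢ univ) :
    HasFDerivWithinAt (fun q : ℝ × Conf N => (q.1, x q.1 q.2)) (rayDifferential L x p q.1 q.2)
      (Icc 0 T ×ˢ univ) q :=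
  hasFDerivWithinAt_fst.prodMk (hasFDerivWithinAt_uncurry (convex_Icc 0 T) hq.1
    (fun a _ ht => h.hasDerivWithinAt_position a ht) (h.continuousOn_rayState q hq).snd.fst
    ((h.diffeo q.1 hq.1).contDiff.differentiable one_ne_zero q.2).hasFDerivAt)

theorem exists_equiv_eq_rayDifferential (h : IsRayFamily L S₀ T x p) {t : ℝ} (ht : t ∈ Icc 0 T)
    (a : Conf N) :
    ∃ B : (ℝ × Conf N) ≃L[ℝ] ℝ × Conf N, (B : ℝ × Conf N →L[ℝ] ℝ × Conf N) =
      rayDifferential L x p t a := by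
  obtain ⟨A, hA⟩ := (h.diffeo t ht).exists_equiv_eq_fderiv a
  refine ⟨.skewProd (.refl ℝ ℝ) A
    (ContinuousLinearMap.toSpanSingleton ℝ (velocity L (x t a, p t a, t))), ?_⟩
  refine ContinuousLinearMap.ext fun q => ?_
  simp [rayDifferential, ← hA, add_comm]

theorem hasFDerivWithinAt_rayAction (h : IsRayFamily L S₀ T x p) {q : ℝ × Conf N}
    (hq : q ∈ Icc 0 T ×ˢ univ) :
    HasFDerivWithinAt (fun q : ℝ × Conf N => rayAction L S₀ T x q.1 q.2)
      ((spacetimeDifferential (-hamiltonian L (x q.1 q.2, p q.1 q.2, q.1)) (p q.1 q.2)).comp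
        (rayDifferential L x p q.1 q.2)) (Icc 0 T ×ˢ univ) q := by
  have hjoint := hasFDerivWithinAt_uncurry (convex_Icc 0 T) hq.1
    (fun a _ ht => h.hasDerivWithinAt_rayAction a ht)
    (h.lagrangian.continuous.continuousAt.comp_continuousWithinAt (h.continuousOn_rayState q hq))
    (h.hasFDerivAt_rayAction q.2 hq.1)
  refine hjoint.congr_fderiv (ContinuousLinearMap.ext fun r => ?_)
  simp only [hamiltonian_eq h.legendre, rayDifferential, rayState, spacetimeDifferential_apply,
    ContinuousLinearMap.comp_apply, ContinuousLinearMap.prod_apply,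
    ContinuousLinearMap.coprod_apply, ContinuousLinearMap.toSpanSingleton_apply,
    ContinuousLinearMap.coe_fst', innerSL_apply_apply, inner_add_right, inner_smul_right,
    smul_eq_mul]
  ring

theorem hasFDerivWithinAt_action (h : IsRayFamily L S₀ T x p) {t : ℝ} (ht : t ∈ Icc 0 T)
    (y : Conf N) :
    HasFDerivWithinAt (fun q : ℝ × Conf N => action L S₀ T x q.1 q.2)
      (spacetimeDifferential (-hamiltonian L (y, p t (Function.invFun (x t) y), t))
        (p t (Function.invFun (x t) y))) (Icc 0 T ×ˢ univ) (t, y) := by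
  set inverse : ℝ × Conf N → ℝ × Conf N := fun q => (q.1, Function.invFun (x q.1) q.2)
  have hmaps : MapsTo inverse (Icc 0 T ×ˢ univ) (Icc 0 T ×ˢ univ) :=
    fun q hq => ⟨hq.1, mem_univ _⟩
  obtain ⟨B, hB⟩ := h.exists_equiv_eq_rayDifferential ht (Function.invFun (x t) y)
  have hcont : ContinuousWithinAt inverse (Icc 0 T ×ˢ univ) (t, y) :=
    continuousWithinAt_fst.prodMk (h.continuousOn_invFun (t, y) ⟨ht, mem_univ _⟩)
  have hinverse : HasFDerivWithinAt inverse (B.symm : ℝ × Conf N →L[ℝ] ℝ × Conf N)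
      (Icc 0 T ×ˢ univ) (t, y) := by
    refine .of_local_left_inverse (hcont.tendsto_nhdsWithin hmaps)
      (hB ▸ h.hasFDerivWithinAt_rayMap (q := inverse (t, y)) ⟨ht, mem_univ _⟩) ⟨ht, mem_univ _⟩ ?_
    filter_upwards [self_mem_nhdsWithin] with q hq
    exact Prod.ext rfl (h.position_invFun hq.1 q.2)
  have hcomp := (h.hasFDerivWithinAt_rayAction (q := inverse (t, y)) ⟨ht, mem_univ _⟩).comp (t, y)
    hinverse hmaps
  simp only [inverse, ← hB, ContinuousLinearMap.comp_assoc,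
    ContinuousLinearEquiv.coe_comp_coe_symm, ContinuousLinearMap.comp_id,
    h.position_invFun ht] at hcomp
  exact hcomp

theorem continuousOn_momentum_invFun (h : IsRayFamily L S₀ T x p) :
    ContinuousOn (fun q : ℝ × Conf N => p q.1 (Function.invFun (x q.1) q.2))
      (Icc 0 T ×ˢ univ) :=
  h.continuousOn_phase.snd.comp (f := fun q : ℝ × Conf N => (q.1, Function.invFun (x q.1) q.2))
    (continuousOn_fst.prodMk h.continuousOn_invFun) fun _ hq => ⟨hq.1, mem_univ _⟩

theorem continuousOn_differential (h : IsRayFamily L S₀ T x p) :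
    ContinuousOn (fun q : ℝ × Conf N => spacetimeDifferential
      (-hamiltonian L (q.2, p q.1 (Function.invFun (x q.1) q.2), q.1))
      (p q.1 (Function.invFun (x q.1) q.2))) (Icc 0 T ×ˢ univ) := by
  have hp := h.continuousOn_momentum_invFun
  have hH := (contDiff_hamiltonian (h.lagrangian.of_le one_le_two)
    h.legendre).continuous.comp_continuousOn
      (continuousOn_snd.prodMk (hp.prodMk continuousOn_fst))
  exact continuous_spacetimeDifferential.comp_continuousOn (hH.neg.prodMk hp)

theorem isHJSolution_action (h : IsRayFamily L S₀ T x p) :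
    IsHJSolution (hamiltonian L) S₀ T (action L S₀ T x) where
  contDiffOn := by
    have hunique : UniqueDiffOn ℝ (Icc 0 T ×ˢ (univ : Set (Conf N))) :=
      (uniqueDiffOn_Icc h.pos).prod uniqueDiffOn_univ
    rw [← zero_add (1 : WithTop ℕ∞),
      contDiffOn_succ_iff_hasFDerivWithinAt_of_uniqueDiffOn hunique]
    exact ⟨by simp, _, contDiffOn_zero.2 h.continuousOn_differential,
      fun q hq => h.hasFDerivWithinAt_action hq.1 q.2⟩
  equation t ht y := by
    have hdiff := h.hasFDerivWithinAt_action ht y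
    rw [(hasGradientAt_of_hasFDerivWithinAt_uncurry hdiff ht).gradient,
      derivWithin_of_hasFDerivWithinAt_uncurry hdiff
        (uniqueDiffOn_Icc h.pos t ht), spacetimeDifferential_apply]
    simp
  initial y := by
    have hinv : Function.invFun (x 0) y = y := by
      simpa only [h.flow.position_zero] using h.position_invFun h.zero_mem y
    rw [action, rayAction_zero, hinv]

end IsRayFamily

end Action

section Uniqueness

theorem eq_spacetimeDifferential {E : Type*} [NormedAddCommGroup E] [InnerProductSpace ℝ E]
    [CompleteSpace E] (D : ℝ × E →L[ℝ] ℝ) :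
    D = spacetimeDifferential (D (1, 0))
      ((InnerProductSpace.toDual ℝ E).symm (D.comp (.inr ℝ ℝ E))) := by
  refine ContinuousLinearMap.ext fun q => ?_
  rw [spacetimeDifferential_apply, InnerProductSpace.toDual_symm_apply,
    ContinuousLinearMap.comp_apply, ← smul_eq_mul, ← map_smul, ← map_add]
  simp

namespace IsHJSolution

variable {H : ExtPhase N → ℝ} {S₀ : Conf N → ℝ} {T : ℝ} {S : ℝ → Conf N → ℝ}

theorem gradient_eq_toDual_symm (hS : IsHJSolution H S₀ T S) {q : ℝ × Conf N}
    (hq : q ∈ Icc 0 T ×ˢ univ) :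
    gradient (S q.1) q.2 = (InnerProductSpace.toDual ℝ (Conf N)).symm
      ((fderivWithin ℝ (fun q : ℝ × Conf N => S q.1 q.2) (Icc 0 T ×ˢ univ) q).comp
        (.inr ℝ ℝ (Conf N))) := by
  have hdiff := (hS.contDiffOn.differentiableOn one_ne_zero q hq).hasFDerivWithinAt
  exact (hasGradientAt_of_hasFDerivWithinAt_uncurry
    (hdiff.congr_fderiv (eq_spacetimeDifferential _)) hq.1).gradient

theorem continuousOn_gradient (hS : IsHJSolution H S₀ T S) (hT : 0 < T) :
    ContinuousOn (fun q : ℝ × Conf N => gradient (S q.1) q.2) (Icc 0 T ×ˢ univ) := by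
  have hunique : UniqueDiffOn ℝ (Icc 0 T ×ˢ (univ : Set (Conf N))) :=
    (uniqueDiffOn_Icc hT).prod uniqueDiffOn_univ
  refine ContinuousOn.congr ?_ fun q hq => hS.gradient_eq_toDual_symm hq
  exact (InnerProductSpace.toDual ℝ (Conf N)).symm.continuous.comp_continuousOn
    ((hS.contDiffOn.continuousOn_fderivWithin hunique le_rfl).clm_comp continuousOn_const)

theorem hasFDerivWithinAt (hS : IsHJSolution H S₀ T S) (hT : 0 < T) {q : ℝ × Conf N}
    (hq : q ∈ Icc 0 T ×ˢ univ) :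
    HasFDerivWithinAt (fun q : ℝ × Conf N => S q.1 q.2)
      (spacetimeDifferential (-H (q.2, gradient (S q.1) q.2, q.1)) (gradient (S q.1) q.2))
      (Icc 0 T ×ˢ univ) q := by
  have hdiff := (hS.contDiffOn.differentiableOn one_ne_zero q hq).hasFDerivWithinAt
  rw [← hS.equation q.1 hq.1 q.2, neg_neg, hS.gradient_eq_toDual_symm hq,
    derivWithin_of_hasFDerivWithinAt_uncurry hdiff (uniqueDiffOn_Icc hT q.1 hq.1),
    ← eq_spacetimeDifferential]
  exact hdiff

end IsHJSolution

variable {L : ExtPhase N → ℝ} {S₀ : Conf N → ℝ} {T : ℝ} {x p : ℝ → Conf N → Conf N}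
  {S : ℝ → Conf N → ℝ}

/-- The difference, along the ray from `a`, between the gradient of `S` and the momentum. -/
def momentumDefect (S : ℝ → Conf N → ℝ) (x p : ℝ → Conf N → Conf N) (t : ℝ) (a : Conf N) :
    Conf N :=
  gradient (S t) (x t a) - p t a

/-- The difference, along the ray from `a`, between the energies `H(x, ∇S, t)` and
`H(x, p, t)`. -/
def energyDefect (L : ExtPhase N → ℝ) (S : ℝ → Conf N → ℝ) (x p : ℝ → Conf N → Conf N) (t : ℝ)
    (a : Conf N) : ℝ :=
  hamiltonian L (x t a, gradient (S t) (x t a), t) - hamiltonian L (x t a, p t a, t)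

theorem spacetimeDifferential_comp_rayDifferential_apply (τ : ℝ) (g : Conf N) (t : ℝ)
    (a : Conf N) :
    (spacetimeDifferential τ g).comp (rayDifferential L x p t a) (1, 0) =
      τ + inner ℝ g (velocity L (x t a, p t a, t)) := by
  simp [spacetimeDifferential_apply, rayDifferential]

theorem spacetimeDifferential_comp_rayDifferential_comp_inr (τ : ℝ) (g : Conf N) (t : ℝ)
    (a : Conf N) :
    ((spacetimeDifferential τ g).comp (rayDifferential L x p t a)).comp (.inr ℝ ℝ (Conf N)) =
      (innerSL ℝ g).comp (fderiv ℝ (x t) a) := by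
  refine ContinuousLinearMap.ext fun η => ?_
  simp [spacetimeDifferential_apply, rayDifferential]

namespace IsRayFamily

theorem hasFDerivWithinAt_sub_rayAction (h : IsRayFamily L S₀ T x p)
    (hS : IsHJSolution (hamiltonian L) S₀ T S) {q : ℝ × Conf N} (hq : q ∈ Icc 0 T ×ˢ univ) :
    HasFDerivWithinAt (fun q : ℝ × Conf N => S q.1 (x q.1 q.2) - rayAction L S₀ T x q.1 q.2)
      ((spacetimeDifferential (-energyDefect L S x p q.1 q.2) (momentumDefect S x p q.1 q.2)).comp
        (rayDifferential L x p q.1 q.2)) (Icc 0 T ×ˢ univ) q := by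
  have hcomp := (hS.hasFDerivWithinAt h.pos (q := (q.1, x q.1 q.2)) ⟨hq.1, mem_univ _⟩).comp q
    (t := Icc 0 T ×ˢ univ) (h.hasFDerivWithinAt_rayMap hq) fun r hr => ⟨hr.1, mem_univ _⟩
  refine (hcomp.fun_sub (h.hasFDerivWithinAt_rayAction hq)).congr_fderiv
    (ContinuousLinearMap.ext fun r => ?_)
  simp only [energyDefect, momentumDefect, sub_apply, ContinuousLinearMap.comp_apply,
    spacetimeDifferential_apply, inner_sub_left]
  ring

theorem continuousOn_gradient_ray (h : IsRayFamily L S₀ T x p)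
    (hS : IsHJSolution (hamiltonian L) S₀ T S) :
    ContinuousOn (fun q : ℝ × Conf N => gradient (S q.1) (x q.1 q.2)) (Icc 0 T ×ˢ univ) :=
  (hS.continuousOn_gradient h.pos).comp (f := fun q : ℝ × Conf N => (q.1, x q.1 q.2))
    (continuousOn_fst.prodMk h.continuousOn_phase.fst) fun _ hq => ⟨hq.1, mem_univ _⟩

theorem momentumDefect_eq_zero_of_eventually (h : IsRayFamily L S₀ T x p)
    (hS : IsHJSolution (hamiltonian L) S₀ T S) {t : ℝ} (ht : t ∈ Icc 0 T) {a : Conf N}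
    (heq : ∀ᶠ b in 𝓝 a, S t (x t b) - rayAction L S₀ T x t b = 0) :
    momentumDefect S x p t a = 0 := by
  obtain ⟨A, hA⟩ := (h.diffeo t ht).exists_equiv_eq_fderiv a
  have hslice := hasGradientAt_of_hasFDerivWithinAt_uncurry
    (hS.hasFDerivWithinAt h.pos (q := (t, x t a)) ⟨ht, mem_univ _⟩) ht
  have hx := ((h.diffeo t ht).contDiff.differentiable one_ne_zero a).hasFDerivAt
  have hzero := ((hslice.hasFDerivAt.comp a hx).sub (h.hasFDerivAt_rayAction a ht)).unique
    ((hasFDerivAt_const (0 : ℝ) a).congr_of_eventuallyEq heq)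
  refine ext_inner_right ℝ fun η => ?_
  simpa [← hA, momentumDefect, inner_sub_left] using DFunLike.congr_fun hzero (A.symm η)

theorem momentumDefect_eq_zero_of_forall_lt (h : IsRayFamily L S₀ T x p)
    (hS : IsHJSolution (hamiltonian L) S₀ T S) {t : ℝ} (ht : t ∈ Icc 0 T) {a : Conf N}
    (heq : ∀ s ∈ Ico 0 t, ∀ᶠ b in 𝓝 a, S s (x s b) - rayAction L S₀ T x s b = 0) :
    momentumDefect S x p t a = 0 := by
  rcases ht.1.eq_or_lt with rfl | hpos
  · rw [momentumDefect, h.flow.position_zero, h.flow.momentum_zero, funext hS.initial, sub_self]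
  have hcont : ContinuousOn (fun s => momentumDefect S x p s a) (Icc 0 T) :=
    ((h.continuousOn_gradient_ray hS).sub h.continuousOn_phase.snd).comp
      (f := fun s : ℝ => (s, a)) (by fun_prop) fun s hs => ⟨hs, mem_univ _⟩
  have hne : (𝓝[Ico 0 t] t).NeBot := by
    rw [← mem_closure_iff_nhdsWithin_neBot, closure_Ico hpos.ne]
    exact right_mem_Icc.2 hpos.le
  have hsub : Ico 0 t ⊆ Icc 0 T := fun s hs => ⟨hs.1, hs.2.le.trans ht.2⟩
  refine tendsto_nhds_unique_of_eventuallyEq ((hcont t ht).mono hsub) tendsto_const_nhds ?_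
  filter_upwards [self_mem_nhdsWithin] with s hs
  exact h.momentumDefect_eq_zero_of_eventually hS (hsub hs) (heq s hs)

theorem isLittleO_energyDefect_sub (h : IsRayFamily L S₀ T x p)
    (hS : IsHJSolution (hamiltonian L) S₀ T S) {t : ℝ} (ht : t ∈ Icc 0 T) {a : Conf N}
    (hzero : momentumDefect S x p t a = 0) :
    (fun q : ℝ × Conf N => energyDefect L S x p q.1 q.2 -
        inner ℝ (velocity L (x q.1 q.2, p q.1 q.2, q.1)) (momentumDefect S x p q.1 q.2))
      =o[𝓝[Icc 0 T ×ˢ univ] (t, a)] fun q => momentumDefect S x p q.1 q.2 := by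
  have hL := h.lagrangian.of_le one_le_two
  have hphase : ContinuousOn (fun q : ℝ × Conf N => (x q.1 q.2, p q.1 q.2, q.1))
      (Icc 0 T ×ˢ univ) :=
    h.continuousOn_phase.fst.prodMk (h.continuousOn_phase.snd.prodMk continuousOn_fst)
  have hgradient : ContinuousOn (fun q : ℝ × Conf N => (x q.1 q.2, gradient (S q.1) (x q.1 q.2),
      q.1)) (Icc 0 T ×ˢ univ) :=
    h.continuousOn_phase.fst.prodMk ((h.continuousOn_gradient_ray hS).prodMk continuousOn_fst)
  have hlim := (hgradient (t, a) ⟨ht, mem_univ _⟩).tendsto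
  rw [sub_eq_zero.1 hzero] at hlim
  refine (((isLittleO_sub_sub_fderiv_of_contDiff (contDiff_hamiltonian hL h.legendre)
    (x t a, p t a, t)).comp_tendsto (hlim.prodMk_nhds
      (hphase (t, a) ⟨ht, mem_univ _⟩))).trans_isBigO (isBigO_of_le _ fun q => ?_)).congr_left
        fun q => ?_
  · simp [momentumDefect, Prod.norm_def]
  · have := fderiv_hamiltonian (hL.differentiable one_ne_zero) h.legendre
      (x q.1 q.2, p q.1 q.2, q.1) 0 (momentumDefect S x p q.1 q.2)
    rw [inner_zero_right, sub_zero, momentumDefect] at this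
    simp only [Function.comp_apply, energyDefect, momentumDefect, Prod.mk_sub_mk, sub_self, this]

-- In ray coordinates the transport at velocity `H_p` is gone, and only the second order
-- remainder of `H` in the momentum defect drives the difference.
theorem eventually_abs_le_norm_comp_inr (h : IsRayFamily L S₀ T x p)
    (hS : IsHJSolution (hamiltonian L) S₀ T S) {t : ℝ} (ht : t ∈ Icc 0 T) {a : Conf N}
    (hzero : momentumDefect S x p t a = 0) :
    ∀ᶠ q : ℝ × Conf N in 𝓝[Icc 0 T ×ˢ univ] (t, a),
      |(spacetimeDifferential (-energyDefect L S x p q.1 q.2)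
          (momentumDefect S x p q.1 q.2)).comp (rayDifferential L x p q.1 q.2) (1, 0)| ≤
        ‖((spacetimeDifferential (-energyDefect L S x p q.1 q.2)
          (momentumDefect S x p q.1 q.2)).comp (rayDifferential L x p q.1 q.2)).comp
            (.inr ℝ ℝ (Conf N))‖ := by
  obtain ⟨A, hA⟩ := (h.diffeo t ht).exists_equiv_eq_fderiv a
  obtain ⟨C, hC⟩ := exists_eventually_norm_le_norm_comp (G := ℝ) (A := A)
    (hA ▸ h.tendsto_fderiv_position a ht)
  have hbound : (fun q : ℝ × Conf N => momentumDefect S x p q.1 q.2)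
      =O[𝓝[Icc 0 T ×ˢ univ] (t, a)] fun q =>
        (innerSL ℝ (momentumDefect S x p q.1 q.2)).comp (fderiv ℝ (x q.1) q.2) :=
    .of_bound C (hC.mono fun q hq => by
      simpa only [innerSL_apply_norm] using hq (innerSL ℝ (momentumDefect S x p q.1 q.2)))
  filter_upwards [((h.isLittleO_energyDefect_sub hS ht hzero).trans_isBigO hbound).def
    one_pos] with q hq
  rw [spacetimeDifferential_comp_rayDifferential_apply,
    spacetimeDifferential_comp_rayDifferential_comp_inr, neg_add_eq_sub, abs_sub_comm,
    real_inner_comm]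
  simpa only [one_mul, Real.norm_eq_abs] using hq

theorem eq_action (h : IsRayFamily L S₀ T x p) (hS : IsHJSolution (hamiltonian L) S₀ T S)
    {t : ℝ} (ht : t ∈ Icc 0 T) (y : Conf N) : S t y = action L S₀ T x t y := by
  have hzero := eq_zero_of_finite_speed zero_le_one
    (fun q hq => h.hasFDerivWithinAt_sub_rayAction hS hq)
    (fun a => by rw [h.flow.position_zero, rayAction_zero, hS.initial, sub_self])
    (fun s hs a heq => by
      simpa only [one_mul] using h.eventually_abs_le_norm_comp_inr hS hs
        (h.momentumDefect_eq_zero_of_forall_lt hS hs heq))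
    (t, Function.invFun (x t) y) ⟨ht, mem_univ _⟩
  rwa [h.position_invFun ht, sub_eq_zero] at hzero

end IsRayFamily

end Uniqueness

end HamiltonJacobi

end

open HamiltonJacobi in
theorem mainTheorem11 {N : ℕ} (L : ExtPhase N → ℝ) (hL : ContDiff ℝ 2 L)
    (hlegendre : IsC1Diffeo (legendreMap L))
    (S₀ : Conf N → ℝ) (hS₀ : ContDiff ℝ 1 S₀)
    (T : ℝ) (hT : 0 < T)
    (x p : ℝ → Conf N → Conf N)
    (hflow : IsHamiltonFlow (hamiltonian L) S₀ T x p)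
    (hdiffeo : ∀ t ∈ Set.Icc 0 T, IsC1Diffeo (x t)) :
    IsHJSolution (hamiltonian L) S₀ T (action L S₀ T x) ∧
      ∀ S : ℝ → Conf N → ℝ, IsHJSolution (hamiltonian L) S₀ T S →
        ∀ t ∈ Set.Icc 0 T, ∀ y, S t y = action L S₀ T x t y := by
  have h : IsRayFamily L S₀ T x p := ⟨hL, hlegendre, hS₀, hT, hflow, hdiffeo⟩
  exact ⟨h.isHJSolution_action, fun S hS t ht y => h.eq_action hS ht y⟩
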